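/- **Linear Tape Scheduling Problem (LTSP).** A linear tape $[0,m]$ carries $n_f\ge 1$ pairwise disjoint files, ordered from left to right; file $f$ has positive integer size $s(f)$ and occupies $[\ell(f),r(f)]\subseteq[0,m]$, where $\ell(f)$ is an integer and $r(f)=\ell(f)+s(f)$. There are $n\ge 1$ requests, each of which is a file, repetitions allowed. Let $x(f)$ be the number of requests on $f$, $n_{\mathrm{req}}$ the number of requested files, $f_{\min}$ and $f_{\max}$ the leftmost and the rightmost requested file, and $n_\ell(f)$ the number of requests on files strictly to the left of $f$; for a requested file $b\neq f_{\min}$ let $\mathrm{left}(b)$ be the closest requested file to the left of $b$. The reading head starts at position $m$, heading left. A schedule is a trajectory of the head on $[0,m]$ with finitely many U-turns; the head moves at unit speed, and each U-turn takes an additional time $U\ge 0$ ($U$ real). A request is served at the first time at which the head has finished traversing its whole file from left to right in one uninterrupted move. The cost of a schedule that serves all requests is the sum of the service times of the $n$ requests; the problem is to find a schedule of minimum cost $\mathrm{OPT}$. **Dynamic program.** For requested files $a\le b$ and $k\in\mathbb N$ (the number $n_{\mathrm{skip}}$ of skipped requests), let $$T[b,b,k]=2\,s(b)\,(k+n_\ell(b)),$$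 and for $a<b$ let $$T[a,b,k]=\min\Bigl(\mathrm{skip}(a,b,k),\ \min_{c\ \text{requested},\ a<c\le b}\mathrm{detour}_c(a,b,k)\Bigr),$$ $$\mathrm{skip}(a,b,k)=T[a,\mathrm{left}(b),k+x(b)]+2\,(r(b)-r(\mathrm{left}(b)))\,(k+n_\ell(a))+2\,(\ell(b)-r(\mathrm{left}(b)))\,x(b),$$ $$\mathrm{detour}_c(a,b,k)=T[a,\mathrm{left}(c),k]+T[c,b,k]+2\,(r(b)-r(\mathrm{left}(c)))\,(k+n_\ell(a))+2\,U\,(k+n_\ell(c)).$$ Let $\mathrm{VirtualLB}=\sum_f x(f)\,(m-\ell(f)+s(f)+U)$. The algorithm DP determines the requested files and their multiplicities from the list of requests, tabulates the cells $T[a,b,k]$ for all requested $a\le b$ and all $k$ up to the number of requests on files strictly to the right of $b$, recovers from the minimizing choices a set of detours $(c,b)$, and outputs the schedule that performs, by decreasing starting file, all these detours and finally the detour $(f_{\min},f_{\max})$ (a detour $(c,b)$ moves left to $\ell(c)$, turns, and moves right to $r(b)$), together with the value $T[f_{\min},f_{\max},0]+\mathrm{VirtualLB}$. **Theorem.** DP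 solves LTSP exactly: the minimum cost exists and $$\mathrm{OPT}=T[f_{\min},f_{\max},0]+\mathrm{VirtualLB};$$ DP computes the table $T$ correctly, outputs this value, and outputs a schedule that serves all requests at this cost. On a random access machine that performs arithmetic operations, comparisons and accesses to memory in constant time (with the position and size of each file available in constant time), DP runs in time $O(n_{\mathrm{req}}^3\cdot n)$, with an absolute constant. -/

import Mathlib

/-! ## The Linear Tape Scheduling Problem -/

/-- An instance. The tape is `[0, m]`; the files are numbered `0, …, nf - 1` from left to right, file
`f` occupies `[ℓ f, ℓ f + s f]`; the `n` requests are the files `req 0, …, req (n - 1)`, repetitions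
allowed; `U` is the time penalty of a U-turn. (Values of `ℓ`, `s`, `req` out of range are unused.) -/
structure LTSP where
  m : ℕ
  nf : ℕ
  ℓ : ℕ → ℕ
  s : ℕ → ℕ
  size_pos : ∀ f < nf, 0 < s f
  disjoint : ∀ f g, f < g → g < nf → ℓ f + s f ≤ ℓ g
  fits : ∀ f < nf, ℓ f + s f ≤ m
  n : ℕ
  n_pos : 0 < n
  req : ℕ → ℕ
  req_lt : ∀ i < n, req i < nf
  U : ℝ
  U_nonneg : 0 ≤ U

namespace LTSP

/-- Position of the right end of a file. -/
def r (I : LTSP) (f : ℕ) : ℕ := I.ℓ f + I.s f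

/-- The set of requested files. -/
def requested (I : LTSP) : Finset ℕ := (Finset.range I.n).image I.req

/-- The number of requested files. -/
def nreq (I : LTSP) : ℕ := I.requested.card

/-- The number of requests on file `f`. -/
def x (I : LTSP) (f : ℕ) : ℕ := ((Finset.range I.n).filter fun i => I.req i = f).card

/-- The number of requests on files located on the left of `f`, excluding `f`. -/
def nleft (I : LTSP) (f : ℕ) : ℕ := ((Finset.range I.n).filter fun i => I.req i < f).card

/-- The number of requests on files located on the right of `f`, excluding `f`. -/
def nright (I : LTSP) (f : ℕ) : ℕ := ((Finset.range I.n).filter fun i => f < I.req i).card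

theorem requested_nonempty (I : LTSP) : I.requested.Nonempty :=
  ⟨I.req 0, Finset.mem_image_of_mem _ (Finset.mem_range.2 I.n_pos)⟩

/-- The leftmost requested file. -/
def first (I : LTSP) : ℕ := I.requested.min' I.requested_nonempty

/-- The rightmost requested file. -/
def last (I : LTSP) : ℕ := I.requested.max' I.requested_nonempty

/-! ### Schedules -/

/-- A trajectory of the head, made of finitely many straight moves. Move number `k` goes from `pos k`
to `pos (k + 1)`. The head starts at the right end of the tape; moves of even number go to the left,
moves of odd number go to the right, so there is a U-turn between any two consecutive moves.
(Values `pos k` with `k > moves` are unused.) -/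
structure Trajectory (I : LTSP) where
  moves : ℕ
  pos : ℕ → ℝ
  start : pos 0 = I.m
  on_tape : ∀ k ≤ moves, 0 ≤ pos k ∧ pos k ≤ I.m
  goes_left : ∀ k < moves, Even k → pos (k + 1) < pos k
  goes_right : ∀ k < moves, Odd k → pos k < pos (k + 1)

namespace Trajectory

variable {I : LTSP}

/-- The time at which move `k` starts: the earlier moves were made at unit speed, and each of them
was followed by a U-turn, which takes time `U`. -/
noncomputable def clock (τ : I.Trajectory) (k : ℕ) : ℝ :=
  ∑ j ∈ Finset.range k, (|τ.pos (j + 1) - τ.pos j| + I.U)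

/-- The times at which the head finishes traversing file `f` from the left to the right. -/
def readTimes (τ : I.Trajectory) (f : ℕ) : Set ℝ :=
  {t | ∃ k < τ.moves, Odd k ∧ τ.pos k ≤ I.ℓ f ∧ (I.r f : ℝ) ≤ τ.pos (k + 1) ∧
    t = τ.clock k + (I.r f - τ.pos k)}

/-- All requests are served. -/
def Feasible (τ : I.Trajectory) : Prop := ∀ i < I.n, (τ.readTimes (I.req i)).Nonempty

/-- The service time of a file: the first time at which it has been read (`readTimes` is finite, and
it is nonempty for the requested files if the trajectory is feasible). -/
noncomputable def serviceTime (τ : I.Trajectory) (f : ℕ) : ℝ := sInf (τ.readTimes f)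

/-- The sum of the service times of all requests. -/
noncomputable def cost (τ : I.Trajectory) : ℝ :=
  ∑ i ∈ Finset.range I.n, τ.serviceTime (I.req i)

end Trajectory

/-- `VirtualLB = ∑_f x(f) (m - ℓ(f) + s(f) + U)`. -/
noncomputable def virtualLB (I : LTSP) : ℝ :=
  ∑ f ∈ Finset.range I.nf, (I.x f : ℝ) * ((I.m : ℝ) - I.ℓ f + I.s f + I.U)

/-! ### The dynamic program -/

/-- The closest requested file on the left of `b` (`0` if there is none). -/
def leftOf (I : LTSP) (b : ℕ) : ℕ := (I.requested.filter fun f => f < b).sup id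

theorem leftOf_lt (I : LTSP) {b : ℕ} (hb : 0 < b) : I.leftOf b < b := by
  unfold leftOf
  rw [Finset.sup_lt_iff (by simpa using hb)]
  intro f hf
  exact (Finset.mem_filter.1 hf).2

/-- `skip(a, b, k)`, where `t` stands for the value `T[a, left(b), k + x(b)]`. -/
noncomputable def skipCost (I : LTSP) (t : ℝ) (a b k : ℕ) : ℝ :=
  t + 2 * ((I.r b : ℝ) - I.r (I.leftOf b)) * ((k : ℝ) + I.nleft a)
    + 2 * ((I.ℓ b : ℝ) - I.r (I.leftOf b)) * I.x b

/-- `detour_c(a, b, k)`, where `t` and `t'` stand for `T[a, left(c), k]` and `T[c, b, k]`. -/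
noncomputable def detourCost (I : LTSP) (t t' : ℝ) (a b c k : ℕ) : ℝ :=
  t + t' + 2 * ((I.r b : ℝ) - I.r (I.leftOf c)) * ((k : ℝ) + I.nleft a)
    + 2 * I.U * ((k : ℝ) + I.nleft c)

/-- The cell `T[a, b, k]`, for requested files `a ≤ b`: it is `2 s(b) (k + nleft b)` if `a = b`, and
otherwise the minimum of `skip(a, b, k)` and of all `detour_c(a, b, k)`, where `c` ranges over the
requested files with `a < c ≤ b`. -/
noncomputable def T (I : LTSP) (a b k : ℕ) : ℝ :=
  if h : b ≤ a then 2 * (I.s b : ℝ) * ((k : ℝ) + I.nleft b)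
  else
    (I.requested.filter fun c => a < c ∧ c ≤ b).attach.fold min
      (I.skipCost (I.T a (I.leftOf b) (k + I.x b)) a b k)
      (fun c => I.detourCost (I.T a (I.leftOf c.1) k) (I.T c.1 b k) a b c.1 k)
termination_by b - a
decreasing_by
  · have := I.leftOf_lt (b := b) (by omega)
    omega
  · have hc := (Finset.mem_filter.1 c.2).2
    have := I.leftOf_lt (b := c.1) (by omega)
    omega
  · have hc := (Finset.mem_filter.1 c.2).2
    omega

end LTSP

/-! ## A random access machine

The machine has natural-number words (indices and counters) and numeric words (lengths, times and
costs). It has arrays of both kinds, named by fixed numbers and indexed by tuples of natural-number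
words. A program binds intermediate results to variables of the abstract types `N` and `V`; as
a program is parametric in these types, it can use words only through the instructions. -/

/-- Programs. In an instruction that yields a word, the last argument is the rest of the program. -/
inductive Prog (N V : Type) : Type
  | halt : Prog N V
  | seq (p q : Prog N V) : Prog N V
  /-- a constant -/
  | const (c : ℕ) (k : N → Prog N V) : Prog N V
  | addN (u v : N) (k : N → Prog N V) : Prog N V
  /-- truncated subtraction -/
  | subN (u v : N) (k : N → Prog N V) : Prog N V
  /-- conversion of a counter to a numeric word -/
  | cast (u : N) (k : V → Prog N V) : Prog N V
  | addV (u v : V) (k : V → Prog N V) : Prog N V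
  | subV (u v : V) (k : V → Prog N V) : Prog N V
  | mulV (u v : V) (k : V → Prog N V) : Prog N V
  | loadN (arr : ℕ) (idx : List N) (k : N → Prog N V) : Prog N V
  | storeN (arr : ℕ) (idx : List N) (u : N) : Prog N V
  | loadV (arr : ℕ) (idx : List N) (k : V → Prog N V) : Prog N V
  | storeV (arr : ℕ) (idx : List N) (u : V) : Prog N V
  /-- if `u < v` then `p` else `q` -/
  | ifLtN (u v : N) (p q : Prog N V) : Prog N V
  /-- if `u < v` then `p` else `q` -/
  | ifLtV (u v : V) (p q : Prog N V) : Prog N V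
  /-- for `i = 0, …, u - 1` do `body i` -/
  | loop (u : N) (body : N → Prog N V) : Prog N V

/-- The memory: contents of the arrays. -/
structure Mem (V : Type) where
  nat : ℕ → List ℕ → ℕ
  val : ℕ → List ℕ → V

namespace Mem

/-- The memory after a natural-number word has been stored. -/
def setNat {V : Type} (μ : Mem V) (arr : ℕ) (idx : List ℕ) (u : ℕ) : Mem V :=
  { μ with nat := fun a i => if a = arr ∧ i = idx then u else μ.nat a i }

/-- The memory after a numeric word has been stored. -/
def setVal {V : Type} (μ : Mem V) (arr : ℕ) (idx : List ℕ) (u : V) : Mem V :=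
  { μ with val := fun a i => if a = arr ∧ i = idx then u else μ.val a i }

end Mem

namespace Prog

infixr:30 " ;; " => Prog.seq

/-- Execution of a program: the final memory and the number of steps. Arithmetic instructions, tests
and loop iterations take one step each (besides the steps of what they start); an access to an array
takes one step, and one more for each of its indices. -/
def run {V : Type} [CommRing V] [LinearOrder V] : Prog ℕ V → Mem V → Mem V × ℕ
  | halt, μ => (μ, 0)
  | seq p q, μ =>
    let o := p.run μ
    let o' := q.run o.1
    (o'.1, o.2 + o'.2)
  | const c k, μ => let o := (k c).run μ; (o.1, o.2 + 1)
  | addN u v k, μ => let o := (k (u + v)).run μ; (o.1, o.2 + 1)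
  | subN u v k, μ => let o := (k (u - v)).run μ; (o.1, o.2 + 1)
  | cast u k, μ => let o := (k (u : V)).run μ; (o.1, o.2 + 1)
  | addV u v k, μ => let o := (k (u + v)).run μ; (o.1, o.2 + 1)
  | subV u v k, μ => let o := (k (u - v)).run μ; (o.1, o.2 + 1)
  | mulV u v k, μ => let o := (k (u * v)).run μ; (o.1, o.2 + 1)
  | loadN arr idx k, μ => let o := (k (μ.nat arr idx)).run μ; (o.1, o.2 + idx.length + 1)
  | storeN arr idx u, μ => (μ.setNat arr idx u, idx.length + 1)
  | loadV arr idx k, μ => let o := (k (μ.val arr idx)).run μ; (o.1, o.2 + idx.length + 1)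
  | storeV arr idx u, μ => (μ.setVal arr idx u, idx.length + 1)
  | ifLtN u v p q, μ =>
    let o := if u < v then p.run μ else q.run μ
    (o.1, o.2 + 1)
  | ifLtV u v p q, μ =>
    let o := if u < v then p.run μ else q.run μ
    (o.1, o.2 + 1)
  | loop u body, μ =>
    (List.range u).foldl
      (fun st i => let o := (body i).run st.1; (o.1, st.2 + o.2 + 1)) (μ, 1)

end Prog

/-! ## The algorithm `DP` as a program of the machine -/

namespace DP

/-! Arrays of natural-number words. -/

/-- input: the number of requests -/
abbrev nA : ℕ := 0
/-- input: the list of requests -/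
abbrev reqA : ℕ := 1
/-- number of requested files found so far -/
abbrev qA : ℕ := 2
/-- the requested files, from left to right -/
abbrev fileA : ℕ := 3
/-- the number of requests on each of them -/
abbrev xA : ℕ := 4
/-- the number of requests on the left of each of them -/
abbrev nleftA : ℕ := 5
/-- insertion point of a request -/
abbrev posA : ℕ := 6
/-- whether a request is on a file that was found before -/
abbrev foundA : ℕ := 7
/-- for each cell, the starting file of the best detour, or `0` if skipping is best -/
abbrev choiceA : ℕ := 8
/-- `1 +` the last file of the detour that starts at a file, or `0` if there is no such detour -/
abbrev endA : ℕ := 9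
/-- the number of skipped requests in front of that detour -/
abbrev nskipA : ℕ := 10
/-- current second and third coordinate of a cell -/
abbrev curBA : ℕ := 11
/-- see `curBA` -/
abbrev curKA : ℕ := 12
/-- output: number of moves of the schedule -/
abbrev movesA : ℕ := 13

/-! Arrays of numeric words. -/

/-- input: the U-turn penalty -/
abbrev UA : ℕ := 0
/-- input: the length of the tape -/
abbrev mA : ℕ := 1
/-- input: left ends of the files -/
abbrev ellA : ℕ := 2
/-- input: sizes of the files -/
abbrev sizeA : ℕ := 3
/-- left ends, sizes and right ends of the requested files -/
abbrev LA : ℕ := 4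
/-- see `LA` -/
abbrev SA : ℕ := 5
/-- see `LA` -/
abbrev RA : ℕ := 6
/-- the table; requested files are represented by their ranks `0, …, q - 1` -/
abbrev tableA : ℕ := 7
/-- output: the positions where the moves of the schedule start and end -/
abbrev outA : ℕ := 8
/-- output: the cost of the schedule -/
abbrev costA : ℕ := 9

open Prog

variable {N V : Type}

/-- Insert request `f` into the sorted list of the requested files found so far. -/
def insertReq (f : N) : Prog N V :=
  const 0 fun zero => const 1 fun one =>
  storeN posA [] zero ;;
  storeN foundA [] zero ;;
  loadN qA [] fun q =>
  (loop q fun j =>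
    loadN fileA [j] fun g =>
    ifLtN g f
      (loadN posA [] fun p => addN p one fun p' => storeN posA [] p')
      (ifLtN f g halt
        (storeN foundA [] one ;;
          loadN xA [j] fun c => addN c one fun c' => storeN xA [j] c'))) ;;
  loadN foundA [] fun found =>
  ifLtN found one
    (loadN posA [] fun p =>
      subN q p fun w =>
      (loop w fun j =>
        subN q j fun dst => subN dst one fun src =>
        (loadN fileA [src] fun g => storeN fileA [dst] g) ;;
        (loadN xA [src] fun c => storeN xA [dst] c)) ;;
      storeN fileA [p] f ;;
      storeN xA [p] one ;;
      addN q one fun q' => storeN qA [] q')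
    halt

/-- Sort the requests and collect the data of the requested files. -/
def prepare : Prog N V :=
  const 0 fun zero => const 1 fun one =>
  storeN qA [] zero ;;
  (loadN nA [] fun n => loop n fun i => loadN reqA [i] fun f => insertReq f) ;;
  storeN nleftA [zero] zero ;;
  loadN qA [] fun q => loop q fun i =>
    (loadN nleftA [i] fun c => loadN xA [i] fun xi =>
      addN c xi fun c' => addN i one fun i' => storeN nleftA [i'] c') ;;
    loadN fileA [i] fun f => loadV ellA [f] fun l => loadV sizeA [f] fun s =>
      storeV LA [i] l ;;
      storeV SA [i] s ;;
      addV l s fun r => storeV RA [i] r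

/-- Cell `T[b, b, k]`. -/
def baseCell (b k : N) : Prog N V :=
  loadN nleftA [b] fun nb => addN k nb fun p => cast p fun p' =>
  loadV SA [b] fun s => addV s s fun s2 => mulV s2 p' fun t => storeV tableA [b, b, k] t

/-- Cell `T[a, b, k]`, where `b = a + d` and `d > 0`. -/
def recCell (d a b k : N) : Prog N V :=
  const 0 fun zero => const 1 fun one =>
  loadN nleftA [a] fun na => addN k na fun p => cast p fun p' =>
  loadV RA [b] fun rb =>
  (subN b one fun b' => loadN xA [b] fun xb => addN k xb fun kx => cast xb fun xb' =>
    loadV tableA [a, b', kx] fun t => loadV LA [b] fun lb => loadV RA [b'] fun rb' =>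
    subV rb rb' fun u => addV u u fun u2 => mulV u2 p' fun t₁ =>
    subV lb rb' fun v => addV v v fun v2 => mulV v2 xb' fun t₂ =>
    addV t t₁ fun t' => addV t' t₂ fun t'' =>
    storeV tableA [a, b, k] t'') ;;
  storeN choiceA [a, b, k] zero ;;
  loop d fun e =>
    addN a e fun c' => addN c' one fun c =>
    loadV tableA [a, c', k] fun t => loadV tableA [c, b, k] fun t' => loadV RA [c'] fun rc' =>
    loadN nleftA [c] fun nc => addN k nc fun w => cast w fun w' => loadV UA [] fun U =>
    subV rb rc' fun u => addV u u fun u2 => mulV u2 p' fun t₁ =>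
    addV U U fun U2 => mulV U2 w' fun t₂ =>
    addV t t' fun t'' => addV t'' t₁ fun t₃ => addV t₃ t₂ fun new =>
    loadV tableA [a, b, k] fun old =>
    ifLtV new old
      (storeV tableA [a, b, k] new ;; storeN choiceA [a, b, k] c)
      halt

/-- Fill the table by increasing rank difference `d = b - a`. The last coordinate `k` of `T[a, b, k]`
goes up to the number of requests on the right of `b`. -/
def fillTable : Prog N V :=
  const 0 fun zero => const 1 fun one =>
  loadN nA [] fun n => loadN qA [] fun q =>
  loop q fun d => subN q d fun w => loop w fun a =>
    addN a d fun b => addN b one fun b1 => loadN nleftA [b1] fun c => subN n c fun rest =>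
    addN rest one fun rest1 => loop rest1 fun k =>
      ifLtN zero d (recCell d a b k) (baseCell b k)

/-- Recover the detours from the choices. A detour from `a` is recorded in `endA [a]`. The first one
to be recorded is the final sweep over all requested files. -/
def traceBack : Prog N V :=
  const 0 fun zero => const 1 fun one =>
  loadN qA [] fun q =>
  storeN endA [zero] q ;;
  storeN nskipA [zero] zero ;;
  loop q fun a => loadN endA [a] fun e =>
    ifLtN zero e
      ((subN e one fun b => storeN curBA [] b) ;;
        (loadN nskipA [a] fun k => storeN curKA [] k) ;;
        loop q fun _ => loadN curBA [] fun b => loadN curKA [] fun k =>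
          ifLtN a b
            (loadN choiceA [a, b, k] fun c =>
              ifLtN zero c
                ((addN b one fun b1 => storeN endA [c] b1) ;;
                  storeN nskipA [c] k ;;
                  subN c one fun c' => storeN curBA [] c')
                ((loadN xA [b] fun xb => addN k xb fun k' => storeN curKA [] k') ;;
                  subN b one fun b' => storeN curBA [] b'))
            halt)
      halt

/-- Write the schedule, which makes the detours by decreasing starting file, and its cost. -/
def writeOutput : Prog N V :=
  const 0 fun zero => const 1 fun one =>
  loadN qA [] fun q => subN q one fun q' => loadV mA [] fun m => loadV UA [] fun U =>
  storeV outA [zero] m ;;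
  storeN movesA [] zero ;;
  (loop q fun i => subN q' i fun a => loadN endA [a] fun e =>
    ifLtN zero e
      (loadN movesA [] fun k => addN k one fun k1 => addN k1 one fun k2 =>
        (loadV LA [a] fun l => storeV outA [k1] l) ;;
        (subN e one fun b => loadV RA [b] fun r => storeV outA [k2] r) ;;
        storeN movesA [] k2)
      halt) ;;
  (loadV tableA [zero, q', zero] fun t => storeV costA [] t) ;;
  loop q fun i =>
    loadV LA [i] fun l => loadV SA [i] fun s => loadN xA [i] fun xi => cast xi fun xi' =>
    subV m l fun u => addV u s fun v => addV v U fun w => mulV xi' w fun t =>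
    loadV costA [] fun c => addV c t fun c' => storeV costA [] c'

/-- The algorithm `DP`. -/
def program (N V : Type) : Prog N V :=
  prepare ;; fillTable ;; traceBack ;; writeOutput

end DP

/-- The memory at the start of the computation: it holds the instance (so the position and the size of
a file can be queried in constant time), and zeros elsewhere. -/
noncomputable def LTSP.initMem (I : LTSP) : Mem ℝ where
  nat := fun arr idx =>
    match arr, idx with
    | 0, [] => I.n
    | 1, [i] => if i < I.n then I.req i else 0
    | _, _ => 0
  val := fun arr idx =>
    match arr, idx with
    | 0, [] => I.U
    | 1, [] => I.m
    | 2, [f] => if f < I.nf then I.ℓ f else 0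
    | 3, [f] => if f < I.nf then I.s f else 0
    | _, _ => 0

/-- The final memory of `DP` on an instance. -/
noncomputable def LTSP.output (I : LTSP) : Mem ℝ := ((DP.program ℕ ℝ).run I.initMem).1

/-- The running time of `DP` on an instance. -/
noncomputable def LTSP.runningTime (I : LTSP) : ℕ := ((DP.program ℕ ℝ).run I.initMem).2

/-! Everything passes through sets of detours `e`, executed by decreasing start, with the final
sweep from rank 0 as the last one. A file `f` is first read by the detour with the largest start `c
≤ f` that extends to `f`, namely `reader e f`. Beyond its share of `VirtualLB`, a request on `f`
then waits for twice the length plus penalty of each detour with a start beyond `reader e f`, and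
for twice the distance between the left ends of `f` and of its reader; half of this is
`halfDelayOf`. Exchanging sums (`halfDelay_eq_sum`) turns the total into `halfDelay e 0 (nreq - 1)
0`. This quantity has an analogue for each cell `[a, b, k]`: detours are cut off at `b`, and `k +
before a` outside requests wait for all of them.

`halfDelay` obeys the recursion of the table. If no detour with a start in `(a, b]` covers `b`, it
satisfies the skip equation (`halfDelay_skip`). If the detour from `c` covers `b`, it satisfies the
detour equation plus an error term (`halfDelay_detour`), which is the part of the detours from `(a,
c)` that sticks out beyond the file before `c`. The error is nonnegative, so `cell_le_halfDelay`
holds for arbitrary, possibly crossing, detours and no uncrossing argument is needed. It vanishes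
for nested detours, in particular for those recovered from minimizing choices
(`Attains.halfDelay_eq`).

Lower bound: from an arbitrary feasible trajectory extract a detour for each `c`, recording the
farthest file reached after the head first turns at or left of `c` and before it does so for `c -
1`. The triangle inequality for the clock shows that the head is never earlier than these detours
allow (`Feasible.le_clock_reach`, `Feasible.le_readTime`), which gives `Feasible.le_cost`. Upper
bound: performing the recovered detours reads every file no later than the same formula predicts
(`Performs.mem_readTimes`); with the lower bound this forces equality of costs.

For the program, `Spec` is a weakest-precondition calculus that also counts steps. Its only
nontrivial rule is the loop rule `spec_loop`; each phase of `DP` is verified with loop invariants,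
and filling the table dominates the running time. -/

/-! ## Ranks of the requested files -/

namespace LTSP

variable (I : LTSP)

/-- The requested file of rank `j`. -/
noncomputable def file (j : ℕ) : ℕ := Nat.nth (fun f => f ∈ I.requested) j

/-- Left end of the requested file of rank `j`. -/
noncomputable def lpos (j : ℕ) : ℝ := I.ℓ (I.file j)

/-- Right end of the requested file of rank `j`. -/
noncomputable def rpos (j : ℕ) : ℝ := I.r (I.file j)

/-- Number of requests on the requested file of rank `j`. -/
noncomputable def mult (j : ℕ) : ℕ := I.x (I.file j)

/-- Number of requests on the requested files of rank less than `j`. -/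
noncomputable def before (j : ℕ) : ℕ := ∑ i ∈ Finset.range j, I.mult i

theorem before_succ (j : ℕ) : I.before (j + 1) = I.before j + I.mult j :=
  Finset.sum_range_succ _ _

theorem before_zero : I.before 0 = 0 := rfl

theorem finite_requested : {f | f ∈ I.requested}.Finite := I.requested.finite_toSet

theorem card_requested : I.finite_requested.toFinset.card = I.nreq := by
  unfold nreq
  congr 1
  ext f
  simp

theorem nreq_pos : 0 < I.nreq := Finset.card_pos.2 I.requested_nonempty

theorem file_mem {j : ℕ} (hj : j < I.nreq) : I.file j ∈ I.requested :=
  Nat.nth_mem_of_lt_card (p := fun f => f ∈ I.requested) I.finite_requested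
    (by rwa [I.card_requested])

theorem file_lt {i j : ℕ} (hij : i < j) (hj : j < I.nreq) : I.file i < I.file j :=
  Nat.nth_lt_nth_of_lt_card (p := fun f => f ∈ I.requested) I.finite_requested hij
    (by rwa [I.card_requested])

theorem file_le {i j : ℕ} (hij : i ≤ j) (hj : j < I.nreq) : I.file i ≤ I.file j := by
  rcases hij.eq_or_lt with rfl | h
  · rfl
  · exact (I.file_lt h hj).le

theorem file_lt_iff {i j : ℕ} (hi : i < I.nreq) (hj : j < I.nreq) :
    I.file i < I.file j ↔ i < j := by
  refine ⟨fun h => ?_, fun h => I.file_lt h hj⟩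
  by_contra hc
  exact absurd (I.file_le (not_lt.1 hc) hi) (by omega)

theorem file_le_iff {i j : ℕ} (hi : i < I.nreq) (hj : j < I.nreq) :
    I.file i ≤ I.file j ↔ i ≤ j := by
  rw [← not_lt, I.file_lt_iff hj hi, not_lt]

theorem file_inj {i j : ℕ} (hi : i < I.nreq) (hj : j < I.nreq) (h : I.file i = I.file j) :
    i = j :=
  le_antisymm ((I.file_le_iff hi hj).1 h.le) ((I.file_le_iff hj hi).1 h.ge)

theorem exists_file {f : ℕ} (hf : f ∈ I.requested) : ∃ j < I.nreq, I.file j = f := by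
  obtain ⟨j, hj, h⟩ := Nat.exists_lt_card_finite_nth_eq (p := fun f => f ∈ I.requested)
    I.finite_requested hf
  exact ⟨j, by rwa [I.card_requested] at hj, h⟩

theorem requested_eq_image : I.requested = (Finset.range I.nreq).image I.file := by
  ext f
  simp only [Finset.mem_image, Finset.mem_range]
  refine ⟨fun h => I.exists_file h, ?_⟩
  rintro ⟨j, hj, rfl⟩
  exact I.file_mem hj

/-- An increasing enumeration of a finite set is unique: exactly `j` members lie below `a j`, so
`Nat.nth_count` identifies `a j`. This is how the sorted array of the program is recognized as
`file`. -/
theorem file_eq_of_sorted {a : ℕ → ℕ} {q : ℕ} (hmono : ∀ i j, i < j → j < q → a i < a j)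
    (hmem : ∀ f, f ∈ I.requested ↔ ∃ j < q, a j = f) : q = I.nreq ∧ ∀ j < q, a j = I.file j := by
  have himg : I.requested = (Finset.range q).image a := by
    ext f; simp [hmem]
  have hinj : Set.InjOn a (Finset.range q) := by
    intro i hi j hj h
    simp only [Finset.coe_range, Set.mem_Iio] at hi hj
    rcases lt_trichotomy i j with h' | h' | h'
    · exact absurd (hmono i j h' hj) (by omega)
    · exact h'
    · exact absurd (hmono j i h' hi) (by omega)
  refine ⟨?_, fun j hj => ?_⟩
  · rw [nreq, himg, Finset.card_image_of_injOn hinj, Finset.card_range]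
  · have hc : Nat.count (fun f => f ∈ I.requested) (a j) = j := by
      rw [Nat.count_eq_card_filter_range]
      have : (Finset.range (a j)).filter (fun f => f ∈ I.requested) = (Finset.range j).image a := by
        ext f
        simp only [Finset.mem_filter, Finset.mem_range, hmem, Finset.mem_image]
        constructor
        · rintro ⟨h1, i, hi, rfl⟩
          refine ⟨i, ?_, rfl⟩
          by_contra hc
          rcases (not_lt.1 hc).eq_or_lt with rfl | h'
          · omega
          · exact absurd (hmono j i h' hi) (by omega)
        · rintro ⟨i, hi, rfl⟩
          exact ⟨hmono i j hi hj, i, hi.trans hj, rfl⟩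
      rw [this, Finset.card_image_of_injOn, Finset.card_range]
      exact hinj.mono (by simpa using Finset.range_subset_range.2 hj.le)
    have := Nat.nth_count (p := fun f => f ∈ I.requested) ((hmem (a j)).2 ⟨j, hj, rfl⟩)
    rw [hc] at this
    exact this.symm

theorem first_eq : I.first = I.file 0 := by
  refine le_antisymm (Finset.min'_le _ _ (I.file_mem I.nreq_pos)) ?_
  obtain ⟨j, hj, h⟩ := I.exists_file (Finset.min'_mem _ I.requested_nonempty)
  rw [first, ← h]
  exact I.file_le (Nat.zero_le _) hj

theorem last_eq : I.last = I.file (I.nreq - 1) := by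
  have hq := I.nreq_pos
  refine le_antisymm ?_ (Finset.le_max' _ _ (I.file_mem (by omega)))
  obtain ⟨j, hj, h⟩ := I.exists_file (Finset.max'_mem _ I.requested_nonempty)
  rw [last, ← h]
  exact I.file_le (by omega) (by omega)

theorem leftOf_file {j : ℕ} (h0 : 0 < j) (hj : j < I.nreq) :
    I.leftOf (I.file j) = I.file (j - 1) := by
  refine le_antisymm (Finset.sup_le fun f hf => ?_)
    (Finset.le_sup (f := id) (Finset.mem_filter.2 ⟨I.file_mem (by omega), I.file_lt (by omega) hj⟩))
  obtain ⟨hf, hlt⟩ := Finset.mem_filter.1 hf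
  obtain ⟨i, hi, rfl⟩ := I.exists_file hf
  have := (I.file_lt_iff hi hj).1 hlt
  exact I.file_le (by omega) (by omega)

theorem sum_requests {M : Type} [AddCommMonoid M] (h : ℕ → M) :
    ∑ i ∈ Finset.range I.n, h (I.req i) = ∑ j ∈ Finset.range I.nreq, I.mult j • h (I.file j) := by
  rw [Finset.sum_comp h I.req, show (Finset.range I.n).image I.req = I.requested from rfl,
    requested_eq_image, Finset.sum_image]
  · rfl
  · intro i hi j hj h
    exact I.file_inj (by simpa using hi) (by simpa using hj) h

theorem nleft_file {j : ℕ} (hj : j < I.nreq) : I.nleft (I.file j) = I.before j := by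
  rw [nleft, Finset.card_filter, I.sum_requests (fun f => if f < I.file j then 1 else 0), before]
  rw [← Finset.sum_subset (Finset.range_subset_range.2 hj.le)]
  · refine Finset.sum_congr rfl fun i hi => ?_
    rw [if_pos (I.file_lt (by simpa using hi) hj)]
    simp
  · intro i hi hi'
    simp only [Finset.mem_range, not_lt] at hi hi'
    rw [if_neg (not_lt.2 (I.file_le hi' hi))]
    simp

theorem before_nreq : I.before I.nreq = I.n := by
  have := I.sum_requests (fun _ => 1)
  simpa [before] using this.symm

theorem nleft_add_nright (f : ℕ) : I.nleft f + I.x f + I.nright f = I.n := by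
  unfold nleft x nright
  simp only [Finset.card_filter, ← Finset.sum_add_distrib]
  rw [Finset.sum_congr rfl (g := fun _ => 1), Finset.sum_const, Finset.card_range]
  · simp
  · intro i _
    rcases lt_trichotomy (I.req i) f with h | h | h
    · simp [h, h.ne, h.not_gt]
    · simp [h]
    · simp [h, h.ne', h.not_gt]

theorem nright_file {j : ℕ} (hj : j < I.nreq) :
    I.nright (I.file j) = I.n - I.before (j + 1) := by
  have := I.nleft_add_nright (I.file j)
  rw [I.nleft_file hj] at this
  have h2 := I.before_succ j
  unfold mult at h2
  omega

theorem before_mono {i j : ℕ} (h : i ≤ j) : I.before i ≤ I.before j :=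
  Finset.sum_le_sum_of_subset (Finset.range_subset_range.2 h)

theorem before_le_n {j : ℕ} (hj : j ≤ I.nreq) : I.before j ≤ I.n :=
  I.before_nreq ▸ I.before_mono hj

theorem file_lt_nf {j : ℕ} (hj : j < I.nreq) : I.file j < I.nf := by
  obtain ⟨i, hi, h⟩ := Finset.mem_image.1 (I.file_mem hj)
  rw [← h]
  exact I.req_lt i (by simpa using hi)

theorem rpos_eq (j : ℕ) : I.rpos j = I.lpos j + I.s (I.file j) := by
  simp [rpos, lpos, r]

theorem lpos_lt_rpos {j : ℕ} (hj : j < I.nreq) : I.lpos j < I.rpos j := by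
  have := I.size_pos _ (I.file_lt_nf hj)
  rw [rpos_eq]
  have : (0 : ℝ) < I.s (I.file j) := by exact_mod_cast this
  linarith

theorem rpos_le_lpos {i j : ℕ} (hij : i < j) (hj : j < I.nreq) : I.rpos i ≤ I.lpos j := by
  have := I.disjoint _ _ (I.file_lt hij hj) (I.file_lt_nf hj)
  unfold rpos lpos r
  exact_mod_cast this

theorem lpos_mono {i j : ℕ} (hij : i ≤ j) (hj : j < I.nreq) : I.lpos i ≤ I.lpos j := by
  rcases hij.eq_or_lt with rfl | h
  · rfl
  · exact (I.lpos_lt_rpos (h.trans hj)).le.trans (I.rpos_le_lpos h hj)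

theorem rpos_mono {i j : ℕ} (hij : i ≤ j) (hj : j < I.nreq) : I.rpos i ≤ I.rpos j := by
  rcases hij.eq_or_lt with rfl | h
  · rfl
  · exact (I.rpos_le_lpos h hj).trans (I.lpos_lt_rpos hj).le

theorem rpos_le_m {j : ℕ} (hj : j < I.nreq) : I.rpos j ≤ I.m := by
  have := I.fits _ (I.file_lt_nf hj)
  unfold rpos r
  exact_mod_cast this

theorem lpos_nonneg (j : ℕ) : 0 ≤ I.lpos j := Nat.cast_nonneg _

theorem x_pos_iff (f : ℕ) : 0 < I.x f ↔ f ∈ I.requested := by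
  simp only [x, requested, Finset.card_pos, Finset.Nonempty, Finset.mem_filter, Finset.mem_image]

theorem virtualLB_eq : I.virtualLB = ∑ j ∈ Finset.range I.nreq,
    (I.mult j : ℝ) * (I.m - I.lpos j + I.s (I.file j) + I.U) := by
  rw [virtualLB, ← Finset.sum_subset (s₁ := I.requested), requested_eq_image, Finset.sum_image]
  · rfl
  · intro i hi j hj h
    exact I.file_inj (by simpa using hi) (by simpa using hj) h
  · intro f hf
    obtain ⟨i, hi, rfl⟩ := Finset.mem_image.1 hf
    exact Finset.mem_range.2 (I.req_lt i (by simpa using hi))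
  · intro f _ hf
    have : I.x f = 0 := by
      by_contra h
      exact hf ((I.x_pos_iff f).1 (Nat.pos_of_ne_zero h))
    simp [this]

/-! ### The recursion for `T` in terms of ranks -/

/-- The cell of the requested files of ranks `a` and `b`. -/
noncomputable def cell (a b k : ℕ) : ℝ := I.T (I.file a) (I.file b) k

/-- The value of skipping, in terms of ranks. -/
noncomputable def skipValue (a b k : ℕ) : ℝ :=
  I.cell a (b - 1) (k + I.mult b) + 2 * (I.rpos b - I.rpos (b - 1)) * ((k : ℝ) + I.before a)
    + 2 * (I.lpos b - I.rpos (b - 1)) * I.mult b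

/-- The value of a detour, in terms of ranks. -/
noncomputable def detourValue (a b k c : ℕ) : ℝ :=
  I.cell a (c - 1) k + I.cell c b k + 2 * (I.rpos b - I.rpos (c - 1)) * ((k : ℝ) + I.before a)
    + 2 * I.U * ((k : ℝ) + I.before c)

theorem cell_self {b : ℕ} (hb : b < I.nreq) (k : ℕ) :
    I.cell b b k = 2 * (I.rpos b - I.lpos b) * ((k : ℝ) + I.before b) := by
  rw [cell, T, dif_pos le_rfl, I.nleft_file hb, rpos_eq]
  ring

theorem cell_eq {a b : ℕ} (hab : a < b) (hb : b < I.nreq) (k : ℕ) :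
    I.cell a b k = ((I.requested.filter fun c => I.file a < c ∧ c ≤ I.file b).attach.fold min
      (I.skipValue a b k)
      (fun c => I.detourCost (I.T (I.file a) (I.leftOf c.1) k) (I.T c.1 (I.file b) k)
        (I.file a) (I.file b) c.1 k)) := by
  rw [cell, T, dif_neg (not_le.2 (I.file_lt hab hb))]
  congr 1
  rw [skipCost, skipValue, I.leftOf_file (by omega) hb, I.nleft_file (hab.trans hb)]
  rfl

theorem detourCost_file {a b c : ℕ} (hac : a < c) (hcb : c ≤ b) (hb : b < I.nreq) (k : ℕ) :
    I.detourCost (I.T (I.file a) (I.leftOf (I.file c)) k) (I.T (I.file c) (I.file b) k)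
        (I.file a) (I.file b) (I.file c) k = I.detourValue a b k c := by
  rw [detourCost, detourValue, I.leftOf_file (by omega) (by omega), I.nleft_file (by omega),
    I.nleft_file (by omega)]
  rfl

/-- This bound and the next two express that a cell is the minimum of its candidates; the `fold` is
not opened again afterwards. -/
theorem cell_le_skipValue {a b : ℕ} (hab : a < b) (hb : b < I.nreq) (k : ℕ) :
    I.cell a b k ≤ I.skipValue a b k := by
  rw [I.cell_eq hab hb, Finset.fold_min_le]
  exact Or.inl le_rfl

theorem cell_le_detourValue {a b c : ℕ} (hac : a < c) (hcb : c ≤ b) (hb : b < I.nreq) (k : ℕ) :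
    I.cell a b k ≤ I.detourValue a b k c := by
  rw [I.cell_eq (by omega) hb, Finset.fold_min_le]
  refine Or.inr ⟨⟨I.file c, Finset.mem_filter.2 ⟨I.file_mem (by omega), I.file_lt hac (by omega),
    I.file_le hcb hb⟩⟩, Finset.mem_attach _ _, ?_⟩
  exact (I.detourCost_file hac hcb hb k).le

theorem le_cell {a b : ℕ} (hab : a < b) (hb : b < I.nreq) {k : ℕ} {v : ℝ}
    (h1 : v ≤ I.skipValue a b k) (h2 : ∀ c, a < c → c ≤ b → v ≤ I.detourValue a b k c) :
    v ≤ I.cell a b k := by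
  rw [I.cell_eq hab hb, Finset.le_fold_min]
  refine ⟨h1, ?_⟩
  rintro ⟨f, hf⟩ _
  obtain ⟨hf, h3, h4⟩ := Finset.mem_filter.1 hf
  obtain ⟨c, hc, rfl⟩ := I.exists_file hf
  have hac := (I.file_lt_iff (hab.trans hb) hc).1 h3
  have hcb := (I.file_le_iff hc hb).1 h4
  exact (h2 c hac hcb).trans (I.detourCost_file hac hcb hb k).ge

end LTSP

/-! ## Sets of detours

A set of detours is described by a function `e`: there is a detour that starts at the requested file
of rank `c` if and only if `0 < e c`, and it then ends at the requested file of rank `e c - 1`. -/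

namespace LTSP

/-- The start of the first detour (in the order of execution) that reads the file of rank `f`. -/
def reader (e : ℕ → ℕ) (f : ℕ) : ℕ := Nat.findGreatest (fun c => f < e c) f

theorem reader_le (e : ℕ → ℕ) (f : ℕ) : reader e f ≤ f := Nat.findGreatest_le f

theorem le_reader {e : ℕ → ℕ} {f c : ℕ} (hc : c ≤ f) (h : f < e c) : c ≤ reader e f :=
  Nat.le_findGreatest hc h

/-- The value `0` is excluded because it is also the default of `Nat.findGreatest`; there it stands
for the final sweep, whether or not `e 0` records it. -/
theorem lt_reader_apply {e : ℕ → ℕ} {f : ℕ} (h : reader e f ≠ 0) : f < e (reader e f) :=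
  Nat.findGreatest_of_ne_zero (P := fun c => f < e c) rfl h

variable (I : LTSP)

/-- Half of the duration of the detour that starts at `c`, cut off at the right end of `b`. -/
noncomputable def detourLength (e : ℕ → ℕ) (b c : ℕ) : ℝ :=
  if 0 < e c then I.rpos (min (e c) (b + 1) - 1) - I.lpos c + I.U else 0

/-- The number of requests on files of ranks `a, …, b` that are not read before the detour that
starts at `c` is over. -/
noncomputable def unread (e : ℕ → ℕ) (a b c : ℕ) : ℕ :=
  ∑ f ∈ Finset.Ico a (b + 1), if reader e f < c then I.mult f else 0

/-- Half of the delay that is caused by the part of the schedule that `cell a b k` stands for. -/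
noncomputable def halfDelay (e : ℕ → ℕ) (a b k : ℕ) : ℝ :=
  ∑ c ∈ Finset.Ico (a + 1) (b + 1),
      I.detourLength e b c * ((k : ℝ) + I.before a + I.unread e a b c)
    + (I.rpos b - I.lpos a) * ((k : ℝ) + I.before a)
    + ∑ f ∈ Finset.Ico a (b + 1), (I.mult f : ℝ) * (I.lpos f - I.lpos (max a (reader e f)))

theorem halfDelay_self (e : ℕ → ℕ) (b k : ℕ) :
    I.halfDelay e b b k = (I.rpos b - I.lpos b) * ((k : ℝ) + I.before b) := by
  simp [halfDelay, reader_le]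

/-- No detour with a start in `(a, b + 1]` reads the file `b + 1`, so its requests wait for all of
them, exactly like the `k` requests skipped before; cutting off at `b` instead of `b + 1` changes no
length. -/
theorem halfDelay_skip {e : ℕ → ℕ} {a b : ℕ} (hab : a ≤ b)
    (h : ∀ c, a < c → c ≤ b + 1 → e c ≤ b + 1) (h0 : e (b + 1) = 0) (k : ℕ) :
    I.halfDelay e a (b + 1) k = I.halfDelay e a b (k + I.mult (b + 1))
      + (I.rpos (b + 1) - I.rpos b) * ((k : ℝ) + I.before a)
      + (I.lpos (b + 1) - I.rpos b) * I.mult (b + 1) := by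
  have hr : reader e (b + 1) ≤ a := by
    by_contra hc
    have h1 := lt_reader_apply (e := e) (f := b + 1) (by omega)
    have h2 := h _ (not_le.1 hc) (reader_le _ _)
    omega
  unfold halfDelay
  rw [Finset.sum_Ico_succ_top (a := a + 1) (b := b + 1) (by omega),
    Finset.sum_Ico_succ_top (a := a) (b := b + 1) (by omega), max_eq_left hr,
    show I.detourLength e (b + 1) (b + 1) = 0 by simp [detourLength, h0]]
  rw [Finset.sum_congr rfl (g := fun c => I.detourLength e b c *
    (((k + I.mult (b + 1) : ℕ) : ℝ) + I.before a + I.unread e a b c))]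
  · push_cast
    ring
  · intro c hc
    rw [Finset.mem_Ico] at hc
    have h1 := h c (by omega) (by omega)
    congr 1
    · unfold detourLength
      rw [min_eq_left (by omega), min_eq_left (by omega)]
    · rw [unread, Finset.sum_Ico_succ_top (by omega), if_pos (by omega), ← unread]
      push_cast
      ring

theorem sum_mult_add_before {a c : ℕ} (h : a ≤ c) :
    I.before a + ∑ f ∈ Finset.Ico a c, I.mult f = I.before c :=
  Finset.sum_range_add_sum_Ico _ h

/-- The detour from `d + 1` covers everything up to `b`, so the files split into two independent
cells. The last sum is what the left cell loses because it cuts its detours off at `d` instead of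
`b`. -/
theorem halfDelay_detour {e : ℕ → ℕ} {a b d : ℕ} (had : a ≤ d) (hdb : d + 1 ≤ b)
    (h : b < e (d + 1)) (k : ℕ) :
    I.halfDelay e a b k = I.halfDelay e a d k + I.halfDelay e (d + 1) b k
      + (I.rpos b - I.rpos d) * ((k : ℝ) + I.before a) + I.U * ((k : ℝ) + I.before (d + 1))
      + ∑ c ∈ Finset.Ico (a + 1) (d + 1), (I.detourLength e b c - I.detourLength e d c) *
          ((k : ℝ) + I.before a + I.unread e a d c) := by
  have hr : ∀ f, d + 1 ≤ f → f ≤ b → d + 1 ≤ reader e f := fun f h1 h2 => le_reader h1 (by omega)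
  have hu1 : ∀ c, c ≤ d + 1 → I.unread e a b c = I.unread e a d c := by
    intro c hc
    unfold unread
    rw [← Finset.sum_Ico_consecutive _ (n := d + 1) (by omega) (by omega), Nat.add_eq_left]
    refine Finset.sum_eq_zero fun f hf => if_neg ?_
    rw [Finset.mem_Ico] at hf
    have := hr f hf.1 (by omega)
    omega
  -- Files up to `d` have a reader at most `d`, so all of them are still unread.
  have hu2 : ∀ c, d + 1 ≤ c → I.before a + I.unread e a d c = I.before (d + 1) := by
    intro c hc
    rw [← I.sum_mult_add_before (a := a) (c := d + 1) (by omega)]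
    congr 1
    refine Finset.sum_congr rfl fun f hf => if_pos ?_
    rw [Finset.mem_Ico] at hf
    have := reader_le e f
    omega
  have hu3 : ∀ c, d + 1 ≤ c →
      I.before a + I.unread e a b c = I.before (d + 1) + I.unread e (d + 1) b c := by
    intro c hc
    rw [← hu2 c hc, unread, ← Finset.sum_Ico_consecutive _ (n := d + 1) (by omega) (by omega),
      ← add_assoc]
    rfl
  have hs : ∑ f ∈ Finset.Ico a (b + 1), (I.mult f : ℝ) * (I.lpos f - I.lpos (max a (reader e f)))
      = ∑ f ∈ Finset.Ico a (d + 1), (I.mult f : ℝ) * (I.lpos f - I.lpos (max a (reader e f)))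
      + ∑ f ∈ Finset.Ico (d + 1) (b + 1),
          (I.mult f : ℝ) * (I.lpos f - I.lpos (max (d + 1) (reader e f))) := by
    rw [← Finset.sum_Ico_consecutive _ (n := d + 1) (by omega) (by omega)]
    congr 1
    refine Finset.sum_congr rfl fun f hf => ?_
    rw [Finset.mem_Ico] at hf
    have := hr f hf.1 (by omega)
    rw [max_eq_right (by omega), max_eq_right (by omega)]
  unfold halfDelay
  rw [hs, ← Finset.sum_Ico_consecutive _ (m := a + 1) (n := d + 1) (by omega) (by omega),
    Finset.sum_eq_sum_Ico_succ_bot (a := d + 1) (b := b + 1) (by omega)]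
  have h1 : ∑ c ∈ Finset.Ico (a + 1) (d + 1),
        I.detourLength e b c * ((k : ℝ) + I.before a + I.unread e a b c)
      = ∑ c ∈ Finset.Ico (a + 1) (d + 1),
          I.detourLength e d c * ((k : ℝ) + I.before a + I.unread e a d c)
        + ∑ c ∈ Finset.Ico (a + 1) (d + 1), (I.detourLength e b c - I.detourLength e d c) *
          ((k : ℝ) + I.before a + I.unread e a d c) := by
    rw [← Finset.sum_add_distrib]
    refine Finset.sum_congr rfl fun c hc => ?_
    rw [Finset.mem_Ico] at hc
    rw [hu1 c (by omega)]
    ring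
  have h2 : ∑ c ∈ Finset.Ico (d + 1 + 1) (b + 1),
        I.detourLength e b c * ((k : ℝ) + I.before a + I.unread e a b c)
      = ∑ c ∈ Finset.Ico (d + 1 + 1) (b + 1),
          I.detourLength e b c * ((k : ℝ) + I.before (d + 1) + I.unread e (d + 1) b c) := by
    refine Finset.sum_congr rfl fun c hc => ?_
    rw [Finset.mem_Ico] at hc
    have := hu3 c (by omega)
    rw [add_assoc, add_assoc]
    norm_cast
    rw [this]
  have h3 : (I.before a : ℝ) + I.unread e a b (d + 1) = I.before (d + 1) := by
    rw [hu1 _ le_rfl]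
    exact_mod_cast hu2 _ le_rfl
  have h4 : I.detourLength e b (d + 1) = I.rpos b - I.lpos (d + 1) + I.U := by
    rw [detourLength, if_pos (by omega), min_eq_right (by omega)]
    rfl
  rw [h1, h2, add_assoc (k : ℝ), h3, h4]
  ring

/-- Every detour contains the file it starts at. -/
def WellFormed (e : ℕ → ℕ) : Prop := ∀ c, e c = 0 ∨ c < e c

/-- Induction on `b - a`: any detour that covers `b` serves as the choice in the recursion, and if
there is none, skipping does. Detours may cross. -/
theorem cell_le_halfDelay {e : ℕ → ℕ} (he : WellFormed e) :
    ∀ N a b k : ℕ, b - a ≤ N → a ≤ b → b < I.nreq → I.cell a b k ≤ 2 * I.halfDelay e a b k := by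
  intro N
  induction N with
  | zero =>
    intro a b k h1 h2 hb
    obtain rfl : a = b := by omega
    rw [I.cell_self hb, halfDelay_self, mul_assoc]
  | succ N ih =>
    intro a b k h1 h2 hb
    rcases h2.eq_or_lt with rfl | hab
    · exact ih a a k (by omega) le_rfl hb
    by_cases h : ∃ c, a < c ∧ c ≤ b ∧ b < e c
    · obtain ⟨c, hac, hcb, hc⟩ := h
      obtain ⟨d, rfl⟩ : ∃ d, c = d + 1 := ⟨c - 1, by omega⟩
      refine (I.cell_le_detourValue hac hcb hb k).trans ?_
      rw [I.halfDelay_detour (by omega) hcb hc, detourValue, Nat.add_sub_cancel]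
      have i1 := ih a d k (by omega) (by omega) (by omega)
      have i2 := ih (d + 1) b k (by omega) (by omega) hb
      -- Cutting a detour off earlier can only shorten it; this is the only place where crossing
      -- detours lose.
      have i3 : 0 ≤ ∑ c ∈ Finset.Ico (a + 1) (d + 1),
          (I.detourLength e b c - I.detourLength e d c) *
            ((k : ℝ) + I.before a + I.unread e a d c) := by
        refine Finset.sum_nonneg fun c _ => mul_nonneg ?_ (by positivity)
        rw [sub_nonneg]
        unfold detourLength
        split_ifs
        · have := I.rpos_mono (i := min (e c) (d + 1) - 1) (j := min (e c) (b + 1) - 1)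
            (by omega) (by omega)
          linarith
        · rfl
      linarith
    · push Not at h
      obtain ⟨d, rfl⟩ : ∃ d, b = d + 1 := ⟨b - 1, by omega⟩
      refine (I.cell_le_skipValue hab hb k).trans ?_
      have h0 : e (d + 1) = 0 := by
        have := h (d + 1) hab le_rfl
        rcases he (d + 1) with h' | h' <;> omega
      rw [I.halfDelay_skip (by omega) h h0, skipValue, Nat.add_sub_cancel]
      have i1 := ih a d (k + I.mult (d + 1)) (by omega) (by omega) (by omega)
      linarith

/-- Half of the delay of a request on the file of rank `f`. -/
noncomputable def halfDelayOf (e : ℕ → ℕ) (f : ℕ) : ℝ :=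
  ∑ c ∈ Finset.Ico (reader e f + 1) I.nreq, I.detourLength e (I.nreq - 1) c
    + (I.lpos f - I.lpos (reader e f))

/-- Double counting of pairs (detour, file): `unread` counts the requests whose reader is below `c`,
so a request on `f` collects the lengths of the detours with a start above `reader e f`. -/
theorem halfDelay_eq_sum (e : ℕ → ℕ) :
    I.halfDelay e 0 (I.nreq - 1) 0
      = ∑ f ∈ Finset.range I.nreq, (I.mult f : ℝ) * I.halfDelayOf e f := by
  have hq := I.nreq_pos
  unfold halfDelay halfDelayOf unread
  rw [Nat.sub_add_cancel hq, ← Finset.range_eq_Ico]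
  simp only [before_zero, mul_add, Finset.sum_add_distrib, Nat.zero_max]
  congr 1
  simp only [Nat.cast_zero, zero_add, mul_zero, add_zero, Nat.cast_sum, Finset.mul_sum,
    Finset.sum_const_zero]
  rw [Finset.sum_comm]
  refine Finset.sum_congr rfl fun f _ => ?_
  rw [← Finset.sum_subset (s₁ := Finset.Ico (reader e f + 1) I.nreq)]
  · refine Finset.sum_congr rfl fun c hc => ?_
    rw [Finset.mem_Ico] at hc
    rw [if_pos (by omega), mul_comm]
  · exact Finset.Ico_subset_Ico (by omega) le_rfl
  · intro c hc hc'
    rw [Finset.mem_Ico] at hc hc'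
    rw [if_neg (by omega)]
    simp

end LTSP

/-! ## Every trajectory is at least as slow as some set of detours -/

namespace LTSP

namespace Trajectory

variable {I : LTSP} (τ : I.Trajectory)

theorem clock_add_dist_le {i j : ℕ} (h : i ≤ j) :
    τ.clock i + |τ.pos j - τ.pos i| ≤ τ.clock j := by
  induction j, h using Nat.le_induction with
  | base => simp
  | succ j _ ih =>
    have h1 : τ.clock (j + 1) = τ.clock j + (|τ.pos (j + 1) - τ.pos j| + I.U) :=
      Finset.sum_range_succ _ _
    have h2 := abs_sub_le (τ.pos (j + 1)) (τ.pos j) (τ.pos i)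
    have := I.U_nonneg
    linarith

/-- Distinct indices enclose at least one U-turn, hence the penalty that the previous bound does not
have. -/
theorem clock_add_dist_add_le {i j : ℕ} (h : i < j) :
    τ.clock i + |τ.pos j - τ.pos i| + I.U ≤ τ.clock j := by
  obtain ⟨j, rfl⟩ : ∃ d, j = d + 1 := ⟨j - 1, by omega⟩
  have h0 := τ.clock_add_dist_le (i := i) (j := j) (by omega)
  have h1 : τ.clock (j + 1) = τ.clock j + (|τ.pos (j + 1) - τ.pos j| + I.U) :=
    Finset.sum_range_succ _ _
  have h2 := abs_sub_le (τ.pos (j + 1)) (τ.pos j) (τ.pos i)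
  linarith

/-- The start of the first move that begins on the left of the file of rank `c`. -/
noncomputable def reach (c : ℕ) : ℕ := sInf {k | τ.pos k ≤ I.lpos c}

open Classical in
/-- The detours that a trajectory makes: the one that starts at `c` ends at the last file that is
reached before the head gets beyond the file preceding `c`. -/
noncomputable def detours (c : ℕ) : ℕ :=
  ((Finset.range I.nreq).filter fun b => c ≤ b ∧
    ∃ j, τ.reach c ≤ j ∧ j < τ.reach (c - 1) ∧ I.rpos b ≤ τ.pos (j + 1)).sup (· + 1)

theorem exists_of_detours_pos {c : ℕ} (h : 0 < τ.detours c) :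
    ∃ b < I.nreq, c ≤ b ∧ τ.detours c = b + 1 ∧
      ∃ j, τ.reach c ≤ j ∧ j < τ.reach (c - 1) ∧ I.rpos b ≤ τ.pos (j + 1) := by
  classical
  unfold detours at h ⊢
  obtain ⟨b, hb, hs⟩ := Finset.exists_mem_eq_sup ((Finset.range I.nreq).filter fun b => c ≤ b ∧
      ∃ j, τ.reach c ≤ j ∧ j < τ.reach (c - 1) ∧ I.rpos b ≤ τ.pos (j + 1))
    (Finset.nonempty_iff_ne_empty.2 fun h0 => by rw [h0] at h; simp at h) (fun b : ℕ => b + 1)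
  obtain ⟨h1, h2, h3⟩ := Finset.mem_filter.1 hb
  exact ⟨b, by simpa using h1, h2, hs, h3⟩

theorem lt_detours {b c j : ℕ} (hb : b < I.nreq) (hc : c ≤ b) (h1 : τ.reach c ≤ j)
    (h2 : j < τ.reach (c - 1)) (h3 : I.rpos b ≤ τ.pos (j + 1)) : b < τ.detours c := by
  classical
  exact Finset.le_sup (f := fun b : ℕ => b + 1)
    (Finset.mem_filter.2 ⟨Finset.mem_range.2 hb, hc, j, h1, h2, h3⟩)

theorem wellFormed_detours : WellFormed τ.detours := by
  intro c
  rcases Nat.eq_zero_or_pos (τ.detours c) with h | h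
  · exact Or.inl h
  · obtain ⟨b, _, h1, h2, _⟩ := τ.exists_of_detours_pos h
    omega

variable {τ}

theorem Feasible.nonempty_readTimes (hτ : τ.Feasible) {f : ℕ} (hf : f < I.nreq) :
    (τ.readTimes (I.file f)).Nonempty := by
  obtain ⟨i, hi, h⟩ := Finset.mem_image.1 (I.file_mem hf)
  rw [← h]
  exact hτ i (by simpa using hi)

theorem Feasible.pos_reach_le (hτ : τ.Feasible) {f : ℕ} (hf : f < I.nreq) :
    τ.pos (τ.reach f) ≤ I.lpos f := by
  obtain ⟨t, k, _, _, h, _⟩ := hτ.nonempty_readTimes hf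
  exact Nat.sInf_mem (s := {k | τ.pos k ≤ I.lpos f}) ⟨k, h⟩

theorem reach_le {k f : ℕ} (h : τ.pos k ≤ I.lpos f) : τ.reach f ≤ k := Nat.sInf_le h

theorem Feasible.reach_anti (hτ : τ.Feasible) {c f : ℕ} (hc : c ≤ f) (hf : f < I.nreq) :
    τ.reach f ≤ τ.reach c :=
  reach_le ((hτ.pos_reach_le (hc.trans_lt hf)).trans (I.lpos_mono hc hf))

/-- Subtracting the overshoot `lpos c - pos (reach c)` makes the bound telescope from right to left.
A detour from `c + 1` to `b` forces the head out to `rpos b` and back between the two times, which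
costs twice the distance and two U-turns. -/
theorem Feasible.le_clock_reach (hτ : τ.Feasible) :
    ∀ t c, c + 1 + t = I.nreq → I.m - I.lpos c + I.U +
      2 * ∑ c' ∈ Finset.Ico (c + 1) I.nreq, I.detourLength τ.detours (I.nreq - 1) c' ≤
        τ.clock (τ.reach c) - (I.lpos c - τ.pos (τ.reach c)) := by
  intro t
  induction t with
  | zero =>
    intro c hc
    rw [← hc]
    simp only [Nat.add_zero, Finset.Ico_self, Finset.sum_empty]
    have h1 := hτ.pos_reach_le (f := c) (by omega)
    have h2 : τ.reach c ≠ 0 := by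
      intro h0
      rw [h0, τ.start] at h1
      have := I.lpos_lt_rpos (j := c) (by omega)
      have := I.rpos_le_m (j := c) (by omega)
      linarith
    have h3 := τ.clock_add_dist_add_le (Nat.pos_of_ne_zero h2)
    have h4 := neg_abs_le (τ.pos (τ.reach c) - τ.pos 0)
    rw [τ.start] at h3 h4
    have h5 : τ.clock 0 = 0 := Finset.sum_range_zero _
    linarith
  | succ t ih =>
    intro c hc
    have h0 := ih (c + 1) (by omega)
    rw [Finset.sum_eq_sum_Ico_succ_bot (by omega)]
    have h1 := hτ.pos_reach_le (f := c) (by omega)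
    have h2 := hτ.pos_reach_le (f := c + 1) (by omega)
    have hU := I.U_nonneg
    rcases Nat.eq_zero_or_pos (τ.detours (c + 1)) with h | h
    · rw [show I.detourLength τ.detours (I.nreq - 1) (c + 1) = 0 by simp [detourLength, h]]
      have h3 := τ.clock_add_dist_le (hτ.reach_anti (c := c) (f := c + 1) (by omega) (by omega))
      have h4 := neg_abs_le (τ.pos (τ.reach c) - τ.pos (τ.reach (c + 1)))
      linarith
    · obtain ⟨b, hb, hcb, he, j, hj1, hj2, hj3⟩ := τ.exists_of_detours_pos h
      have h3 : I.detourLength τ.detours (I.nreq - 1) (c + 1)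
          = I.rpos b - I.lpos (c + 1) + I.U := by
        rw [detourLength, if_pos h, he, min_eq_left (by omega)]
        rfl
      rw [h3]
      rw [Nat.add_sub_cancel] at hj2
      -- The turning point beyond `b` lies to the right of `c`, so it is not yet the one that
      -- reaches `c`; this yields the second U-turn.
      have h4 : j + 1 ≠ τ.reach c := by
        intro h4
        rw [← h4] at h1
        have := I.lpos_lt_rpos (j := c) (by omega)
        have := I.rpos_mono (i := c) (j := b) (by omega) hb
        linarith
      have h5 := τ.clock_add_dist_add_le (i := τ.reach (c + 1)) (j := j + 1) (by omega)
      have h6 := τ.clock_add_dist_add_le (i := j + 1) (j := τ.reach c) (by omega)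
      have h7 := neg_abs_le (τ.pos (τ.reach c) - τ.pos (j + 1))
      have h8 := le_abs_self (τ.pos (j + 1) - τ.pos (τ.reach (c + 1)))
      linarith

/-- The move that reads `f` begins after the head has reached `reader τ.detours f`, because the
extracted detours record this very move. The clock bound at that moment and the triangle inequality
do the rest. -/
theorem Feasible.le_readTime (hτ : τ.Feasible) {f : ℕ} (hf : f < I.nreq) {t : ℝ}
    (ht : t ∈ τ.readTimes (I.file f)) :
    I.m - I.lpos f + I.s (I.file f) + I.U + 2 * I.halfDelayOf τ.detours f ≤ t := by
  obtain ⟨k, _, _, h1, h2, rfl⟩ := ht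
  change τ.pos k ≤ I.lpos f at h1
  change I.rpos f ≤ _ at h2
  -- Take the leftmost `c` already reached at move `k`. Either it is `0`, or `k` lies between `reach
  -- c` and `reach (c - 1)`, so that the detour from `c` contains `f`.
  have hex : ∃ c, τ.reach c ≤ k := ⟨f, reach_le h1⟩
  classical
  have hc := Nat.find_spec hex
  have hcf : Nat.find hex ≤ f := Nat.find_min' hex (reach_le h1)
  have hr : τ.reach (reader τ.detours f) ≤ k := by
    rcases Nat.eq_zero_or_pos (Nat.find hex) with h0 | h0
    · rw [h0] at hc
      exact (hτ.reach_anti (Nat.zero_le _) ((reader_le _ _).trans_lt hf)).trans hc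
    · have h3 := Nat.find_min hex (m := Nat.find hex - 1) (by omega)
      have h4 := τ.lt_detours hf hcf hc (not_le.1 h3) h2
      exact (hτ.reach_anti (le_reader hcf h4) ((reader_le _ _).trans_lt hf)).trans hc
  have hrf := reader_le τ.detours f
  have h3 := hτ.le_clock_reach (I.nreq - (reader τ.detours f + 1)) (reader τ.detours f) (by omega)
  have h4 := τ.clock_add_dist_le hr
  have h5 := neg_abs_le (τ.pos k - τ.pos (τ.reach (reader τ.detours f)))
  have h6 := hτ.pos_reach_le (f := reader τ.detours f) (by omega)
  have h7 := I.rpos_eq f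
  rw [show (I.r (I.file f) : ℝ) = I.rpos f from rfl]
  unfold halfDelayOf
  have h8 := le_abs_self (τ.pos k - τ.pos (τ.reach (reader τ.detours f)))
  linarith

theorem cost_eq_sum (τ : I.Trajectory) : τ.cost = ∑ f ∈ Finset.range I.nreq,
    (I.mult f : ℝ) * τ.serviceTime (I.file f) := by
  rw [cost, I.sum_requests]
  simp

theorem Feasible.le_cost (hτ : τ.Feasible) :
    I.T I.first I.last 0 + I.virtualLB ≤ τ.cost := by
  have hq := I.nreq_pos
  have h := I.cell_le_halfDelay τ.wellFormed_detours _ 0 (I.nreq - 1) 0 le_rfl (Nat.zero_le _)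
    (by omega)
  rw [halfDelay_eq_sum] at h
  rw [first_eq, last_eq, virtualLB_eq, cost_eq_sum]
  refine (add_le_add_left h _).trans ?_
  rw [Finset.mul_sum, ← Finset.sum_add_distrib]
  refine Finset.sum_le_sum fun f hf => ?_
  rw [Finset.mem_range] at hf
  have h1 : I.m - I.lpos f + I.s (I.file f) + I.U + 2 * I.halfDelayOf τ.detours f
      ≤ τ.serviceTime (I.file f) :=
    le_csInf (hτ.nonempty_readTimes hf) fun t ht => hτ.le_readTime hf ht
  have h2 := mul_le_mul_of_nonneg_left h1 (Nat.cast_nonneg (α := ℝ) (I.mult f))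
  linarith

end Trajectory

/-! ## The trajectory of a set of detours -/

/-- The time at which the move number `k` starts, for a given sequence of turning points. -/
noncomputable def clockOf (I : LTSP) (p : ℕ → ℝ) (k : ℕ) : ℝ :=
  ∑ j ∈ Finset.range k, (|p (j + 1) - p j| + I.U)

variable {I : LTSP}

theorem clockOf_congr {p p' : ℕ → ℝ} {k : ℕ} (h : ∀ j ≤ k, p' j = p j) :
    I.clockOf p' k = I.clockOf p k := by
  refine Finset.sum_congr rfl fun j hj => ?_
  rw [Finset.mem_range] at hj
  rw [h j (by omega), h (j + 1) (by omega)]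

variable (I)

/-- The first `M` moves with the turning points `p` make the detours of `e` that start at the files
of rank at least `t`. -/
structure Performs (e : ℕ → ℕ) (t M : ℕ) (p : ℕ → ℝ) : Prop where
  start : p 0 = I.m
  even : Even M
  on_tape : ∀ k ≤ M, 0 ≤ p k ∧ p k ≤ I.m
  goes_left : ∀ k < M, Even k → p (k + 1) < p k
  goes_right : ∀ k < M, Odd k → p k < p (k + 1)
  next : ∀ c < t, c < I.nreq → I.lpos c < p M
  clock : I.clockOf p M = I.m - p M
    + 2 * ∑ c ∈ Finset.Ico t I.nreq, I.detourLength e (I.nreq - 1) c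
  reads : ∀ f < I.nreq, t ≤ reader e f → ∃ k < M, Odd k ∧ p k ≤ I.lpos f ∧ I.rpos f ≤ p (k + 1) ∧
    I.clockOf p k + (I.rpos f - p k)
      = I.m - I.lpos f + I.s (I.file f) + I.U + 2 * I.halfDelayOf e f

variable {I}

theorem performs_zero {e : ℕ → ℕ} {p : ℕ → ℝ} (h : p 0 = I.m) : I.Performs e I.nreq 0 p where
  start := h
  even := Even.zero
  on_tape k hk := by
    obtain rfl : k = 0 := by omega
    rw [h]
    exact ⟨Nat.cast_nonneg _, le_rfl⟩
  goes_left k hk := absurd hk (by omega)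
  goes_right k hk := absurd hk (by omega)
  next c _ hc := by
    rw [h]
    exact (I.lpos_lt_rpos hc).trans_le (I.rpos_le_m hc)
  clock := by simp [clockOf, h]
  reads f hf h := absurd (reader_le e f) (by omega)

/-- When `e 0` records the final sweep, the default value `0` of `reader` is a genuine reader as
well. -/
theorem lt_apply_reader {e : ℕ → ℕ} {f : ℕ} (h : f < e 0) : f < e (reader e f) :=
  Nat.findGreatest_spec (P := fun c => f < e c) (Nat.zero_le f) h

/-- Nothing moves, and no file can have `t` as its reader. -/
theorem Performs.of_no_detour {e : ℕ → ℕ} (he0 : e 0 = I.nreq) {t M : ℕ} {p : ℕ → ℝ}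
    (h : I.Performs e (t + 1) M p) (ht : t < I.nreq) (h0 : e t = 0) : I.Performs e t M p :=
  { h with
    next := fun c hc => h.next c (by omega)
    clock := by
      rw [h.clock, Finset.sum_eq_sum_Ico_succ_bot ht,
        show I.detourLength e (I.nreq - 1) t = 0 by simp [detourLength, h0], zero_add]
    reads := fun f hf htf => by
      refine h.reads f hf (lt_of_le_of_ne htf fun hte => ?_)
      have := lt_apply_reader (he0.symm ▸ hf)
      rw [← hte] at this
      omega }

theorem Performs.detour {e : ℕ → ℕ} (he0 : e 0 = I.nreq) {t M b : ℕ} {p p' : ℕ → ℝ}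
    (h : I.Performs e (t + 1) M p) (htb : t ≤ b) (hb : b < I.nreq) (he : e t = b + 1) (hp : ∀ k ≤ M, p' k = p k)
    (h1 : p' (M + 1) = I.lpos t) (h2 : p' (M + 2) = I.rpos b) : I.Performs e t (M + 2) p' := by
  have hlr := (I.lpos_lt_rpos (htb.trans_lt hb)).trans_le (I.rpos_mono htb hb)
  have hnext := h.next t (by omega) (by omega)
  have hM : p' M = p M := hp M le_rfl
  have hlen : I.detourLength e (I.nreq - 1) t = I.rpos b - I.lpos t + I.U := by
    rw [detourLength, if_pos (by omega), he, min_eq_left (by omega)]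
    rfl
  have c0 : I.clockOf p' M = I.clockOf p M := clockOf_congr hp
  have c1 : I.clockOf p' (M + 1) = I.clockOf p M + (p M - I.lpos t) + I.U := by
    rw [clockOf, Finset.sum_range_succ, ← clockOf, c0, h1, hM, abs_of_neg (by linarith)]
    ring
  have c2 : I.clockOf p' (M + 2) = I.clockOf p' (M + 1) + (I.rpos b - I.lpos t) + I.U := by
    rw [clockOf, Finset.sum_range_succ, ← clockOf, h2, h1, abs_of_pos (by linarith)]
    ring
  refine ⟨by rw [hp 0 (Nat.zero_le _), h.start], h.even.add (by decide), ?_, ?_, ?_, ?_, ?_, ?_⟩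
  · intro k hk
    rcases (by omega : k ≤ M ∨ k = M + 1 ∨ k = M + 2) with h' | rfl | rfl
    · rw [hp k h']
      exact h.on_tape k h'
    · rw [h1]
      have := I.rpos_le_m hb
      exact ⟨I.lpos_nonneg t, by linarith⟩
    · rw [h2]
      have := I.lpos_nonneg t
      exact ⟨by linarith, I.rpos_le_m hb⟩
  · intro k hk hek
    rcases (by omega : k < M ∨ k = M ∨ k = M + 1) with h' | rfl | rfl
    · rw [hp k h'.le, hp (k + 1) h']
      exact h.goes_left k h' hek
    · rw [h1, hM]
      exact hnext
    · exact absurd (h.even.add_one) (by rwa [Nat.not_odd_iff_even])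
  · intro k hk hok
    rcases (by omega : k < M ∨ k = M ∨ k = M + 1) with h' | rfl | rfl
    · rw [hp k h'.le, hp (k + 1) h']
      exact h.goes_right k h' hok
    · exact absurd h.even (by rwa [Nat.not_even_iff_odd])
    · rw [h1, h2]
      exact hlr
  · intro c hc _
    rw [h2]
    exact (I.lpos_mono (by omega) (by omega)).trans_lt hlr
  · rw [c2, c1, h.clock, Finset.sum_eq_sum_Ico_succ_bot (htb.trans_lt hb), hlen, h2]
    ring
  · intro f hf htf
    rcases htf.eq_or_lt with hte | htf
    · have hff : f ≤ b := by
        have := lt_apply_reader (he0.symm ▸ hf)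
        rw [← hte] at this
        omega
      refine ⟨M + 1, by omega, h.even.add_one, ?_, ?_, ?_⟩
      · rw [h1, hte]
        exact I.lpos_mono (reader_le e f) hf
      · rw [h2]
        exact I.rpos_mono hff hb
      · rw [c1, h.clock, h1, halfDelayOf, ← hte, rpos_eq]
        ring
    · obtain ⟨k, hk, h3, h4, h5, h6⟩ := h.reads f hf htf
      refine ⟨k, by omega, h3, ?_, ?_, ?_⟩
      · rwa [hp k hk.le]
      · rwa [hp (k + 1) hk]
      · rwa [clockOf_congr fun j hj => hp j (by omega), hp k hk.le]

variable {I : LTSP}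

/-- The trajectory with given turning points that makes the detours of `e`. -/
def Performs.trajectory {e : ℕ → ℕ} {t M : ℕ} {p : ℕ → ℝ} (h : I.Performs e t M p) :
    I.Trajectory where
  moves := M
  pos := p
  start := h.start
  on_tape := h.on_tape
  goes_left := h.goes_left
  goes_right := h.goes_right

theorem Performs.mem_readTimes {e : ℕ → ℕ} {M : ℕ} {p : ℕ → ℝ} (h : I.Performs e 0 M p) {f : ℕ}
    (hf : f < I.nreq) : I.m - I.lpos f + I.s (I.file f) + I.U + 2 * I.halfDelayOf e f
      ∈ h.trajectory.readTimes (I.file f) := by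
  obtain ⟨k, hk, h1, h2, h3, h4⟩ := h.reads f hf (Nat.zero_le _)
  exact ⟨k, hk, h1, h2, h3, h4.symm⟩

theorem Performs.feasible {e : ℕ → ℕ} {M : ℕ} {p : ℕ → ℝ} (h : I.Performs e 0 M p) :
    h.trajectory.Feasible := by
  intro i hi
  obtain ⟨j, hj, h1⟩ := I.exists_file (Finset.mem_image_of_mem I.req (Finset.mem_range.2 hi))
  rw [← h1]
  exact ⟨_, h.mem_readTimes hj⟩

theorem Trajectory.serviceTime_le {τ : I.Trajectory} {f : ℕ} {t : ℝ} (ht : t ∈ τ.readTimes f) :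
    τ.serviceTime f ≤ t := by
  refine csInf_le ⟨0, ?_⟩ ht
  rintro _ ⟨k, _, _, h1, _, rfl⟩
  have h2 : 0 ≤ τ.clock k :=
    Finset.sum_nonneg fun j _ => add_nonneg (abs_nonneg _) I.U_nonneg
  have h3 : (I.ℓ f : ℝ) ≤ I.r f := by exact_mod_cast Nat.le_add_right _ _
  linarith

/-- An inequality suffices: minimality of the listed read times need not be checked, since the
general lower bound supplies the converse for optimal detours. -/
theorem Performs.cost_le {e : ℕ → ℕ} {M : ℕ} {p : ℕ → ℝ} (h : I.Performs e 0 M p) :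
    h.trajectory.cost ≤ 2 * I.halfDelay e 0 (I.nreq - 1) 0 + I.virtualLB := by
  rw [halfDelay_eq_sum, virtualLB_eq, Trajectory.cost_eq_sum, Finset.mul_sum,
    ← Finset.sum_add_distrib]
  refine Finset.sum_le_sum fun f hf => ?_
  have h1 := Trajectory.serviceTime_le (h.mem_readTimes (Finset.mem_range.1 hf))
  have h2 := mul_le_mul_of_nonneg_left h1 (Nat.cast_nonneg (α := ℝ) (I.mult f))
  linarith

theorem Performs.exists_trajectory {e : ℕ → ℕ} {M : ℕ} {p : ℕ → ℝ} (h : I.Performs e 0 M p) :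
    ∃ τ : I.Trajectory, τ.moves = M ∧ (∀ k ≤ τ.moves, τ.pos k = p k) ∧ τ.Feasible ∧
      τ.cost ≤ 2 * I.halfDelay e 0 (I.nreq - 1) 0 + I.virtualLB :=
  ⟨h.trajectory, rfl, fun _ _ => rfl, h.feasible, h.cost_le⟩

/-! ## The detours that are recovered from the minimizing choices -/

/-- The detour that starts at `c` in an optimal solution for the cell `[a, b, k]`: one more than the
rank of its last file, and the number of skipped requests. -/
def recovered (x : ℕ → ℕ) (ch : ℕ → ℕ → ℕ → ℕ) (a b k c : ℕ) : ℕ × ℕ :=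
  if a < b then
    if a < ch a b k ∧ ch a b k ≤ b then
      if c < ch a b k then recovered x ch a (ch a b k - 1) k c
      else if c = ch a b k then (b + 1, k)
      else recovered x ch (ch a b k) b k c
    else recovered x ch a (b - 1) (k + x b) c
  else (0, 0)
termination_by b - a

section

variable (x : ℕ → ℕ) (ch : ℕ → ℕ → ℕ → ℕ)

theorem recovered_of_le {a b : ℕ} (h : b ≤ a) (k c : ℕ) : recovered x ch a b k c = (0, 0) := by
  rw [recovered, if_neg (by omega)]

theorem recovered_skip {a b k : ℕ} (hab : a < b) (h : ¬(a < ch a b k ∧ ch a b k ≤ b)) (c : ℕ) :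
    recovered x ch a b k c = recovered x ch a (b - 1) (k + x b) c := by
  rw [recovered, if_pos hab, if_neg h]

theorem recovered_left {a b k c : ℕ} (h1 : a < ch a b k) (h2 : ch a b k ≤ b) (h : c < ch a b k) :
    recovered x ch a b k c = recovered x ch a (ch a b k - 1) k c := by
  rw [recovered, if_pos (by omega), if_pos ⟨h1, h2⟩, if_pos h]

theorem recovered_here {a b k : ℕ} (h1 : a < ch a b k) (h2 : ch a b k ≤ b) :
    recovered x ch a b k (ch a b k) = (b + 1, k) := by
  rw [recovered, if_pos (by omega), if_pos ⟨h1, h2⟩, if_neg (by omega), if_pos rfl]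

theorem recovered_right {a b k c : ℕ} (h1 : a < ch a b k) (h2 : ch a b k ≤ b) (h : ch a b k < c) :
    recovered x ch a b k c = recovered x ch (ch a b k) b k c := by
  rw [recovered, if_pos (by omega), if_pos ⟨h1, h2⟩, if_neg (by omega), if_neg (by omega)]

/-- The recovered detours are nested: inside a detour from `c`, they are those of the cell given by
its start, its end and its number of skipped requests. This locality allows the detours to be traced
one cell at a time. -/
theorem recovered_spec : ∀ N a b k c, b - a ≤ N → (recovered x ch a b k c).1 ≠ 0 →
    a < c ∧ c < (recovered x ch a b k c).1 ∧ (recovered x ch a b k c).1 ≤ b + 1 ∧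
    ∀ c', c < c' → c' < (recovered x ch a b k c).1 → recovered x ch a b k c' =
      recovered x ch c ((recovered x ch a b k c).1 - 1) (recovered x ch a b k c).2 c' := by
  intro N
  induction N with
  | zero =>
    intro a b k c h h0
    rw [recovered_of_le x ch (by omega)] at h0
    exact absurd rfl h0
  | succ N ih =>
    intro a b k c h h0
    by_cases hab : a < b
    swap
    · rw [recovered_of_le x ch (by omega)] at h0
      exact absurd rfl h0
    by_cases hch : a < ch a b k ∧ ch a b k ≤ b
    · obtain ⟨h1, h2⟩ := hch
      rcases lt_trichotomy c (ch a b k) with h3 | h3 | h3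
      · have hc := recovered_left x ch h1 h2 h3
        rw [hc] at h0 ⊢
        obtain ⟨i1, i2, i3, i4⟩ := ih a _ k c (by omega) h0
        refine ⟨i1, i2, by omega, fun c' h4 h5 => ?_⟩
        rw [recovered_left x ch h1 h2 (by omega)]
        exact i4 c' h4 h5
      · rw [h3, recovered_here x ch h1 h2]
        exact ⟨h1, by simpa using by omega, le_rfl,
          fun c' h4 _ => recovered_right x ch h1 h2 h4⟩
      · have hc := recovered_right x ch h1 h2 h3
        rw [hc] at h0 ⊢
        obtain ⟨i1, i2, i3, i4⟩ := ih _ b k c (by omega) h0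
        refine ⟨by omega, i2, i3, fun c' h4 h5 => ?_⟩
        rw [recovered_right x ch h1 h2 (by omega)]
        exact i4 c' h4 h5
    · have hc := recovered_skip x ch hab hch
      rw [hc] at h0 ⊢
      obtain ⟨i1, i2, i3, i4⟩ := ih a (b - 1) (k + x b) c (by omega) h0
      refine ⟨i1, i2, by omega, fun c' h4 h5 => ?_⟩
      rw [hc]
      exact i4 c' h4 h5

end

variable (I)

/-- The choices `ch` attain the minimum in every cell of the table. -/
def Attains (ch : ℕ → ℕ → ℕ → ℕ) : Prop :=
  ∀ a b k, a < b → b < I.nreq → k + I.before (b + 1) ≤ I.n →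
    (ch a b k = 0 ∧ I.cell a b k = I.skipValue a b k) ∨
    (a < ch a b k ∧ ch a b k ≤ b ∧ I.cell a b k = I.detourValue a b k (ch a b k))

variable {I}

/-- The same induction as for the lower bound, now with equality: choices attain the minimum, and
nestedness annihilates the error term. -/
theorem Attains.halfDelay_eq {ch : ℕ → ℕ → ℕ → ℕ} (hch : I.Attains ch) {e : ℕ → ℕ} :
    ∀ N a b k, b - a ≤ N → a ≤ b → b < I.nreq → k + I.before (b + 1) ≤ I.n →
      (∀ c, a < c → c ≤ b → e c = (recovered I.mult ch a b k c).1) →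
      2 * I.halfDelay e a b k = I.cell a b k := by
  intro N
  induction N with
  | zero =>
    intro a b k h1 h2 hb _ _
    obtain rfl : a = b := by omega
    rw [I.cell_self hb, halfDelay_self, mul_assoc]
  | succ N ih =>
    intro a b k h1 h2 hb hk he
    rcases h2.eq_or_lt with rfl | hab
    · exact ih a a k (by omega) le_rfl hb hk he
    obtain ⟨b, rfl⟩ : ∃ d, b = d + 1 := ⟨b - 1, by omega⟩
    have hbs := I.before_succ (b + 1)
    rcases hch a (b + 1) k hab hb hk with ⟨h3, h4⟩ | ⟨h3, h4, h5⟩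
    · have hr := recovered_skip I.mult ch (k := k) hab (by omega)
      rw [Nat.add_sub_cancel] at hr
      have hle : ∀ c, a < c → c ≤ b + 1 → e c ≤ b + 1 := by
        intro c h5 h6
        rw [he c h5 h6, hr]
        by_contra h7
        have := recovered_spec I.mult ch _ a b (k + I.mult (b + 1)) c le_rfl (by omega)
        omega
      have h0 : e (b + 1) = 0 := by
        rw [he _ (by omega) le_rfl, hr]
        by_contra h7
        have := recovered_spec I.mult ch _ a b (k + I.mult (b + 1)) (b + 1) le_rfl h7
        omega
      have := ih a b (k + I.mult (b + 1)) (by omega) (by omega) (by omega) (by omega)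
        fun c h5 h6 => by rw [he c h5 (by omega), hr]
      rw [I.halfDelay_skip (by omega) hle h0, h4, skipValue, Nat.add_sub_cancel, ← this]
      ring
    · obtain ⟨d, hd⟩ : ∃ d, ch a (b + 1) k = d + 1 := ⟨ch a (b + 1) k - 1, by omega⟩
      have i1 := ih a d k (by omega) (by omega) (by omega)
        ((Nat.add_le_add_left (I.before_mono (by omega)) k).trans hk)
        fun c h6 h7 => by
          rw [he c h6 (by omega), recovered_left I.mult ch h3 h4 (by omega), hd,
            Nat.add_sub_cancel]
      have i2 := ih (d + 1) (b + 1) k (by omega) (by omega) hb hk fun c h6 h7 => by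
          rw [he c (by omega) (by omega), recovered_right I.mult ch h3 h4 (by omega), hd]
      have h6 : e (d + 1) = b + 2 := by
        rw [he (d + 1) (by omega) (by omega), ← hd, recovered_here I.mult ch h3 h4]
      rw [I.halfDelay_detour (d := d) (by omega) (by omega) (by omega), h5, hd, detourValue,
        Nat.add_sub_cancel, ← i1, ← i2, Finset.sum_eq_zero]
      · ring
      -- Detours with a start up to `d` end by `d`, so both cut-offs leave them intact.
      · intro c hc
        rw [Finset.mem_Ico] at hc
        have hle : e c ≤ d + 1 := by
          rw [he c (by omega) (by omega), recovered_left I.mult ch h3 h4 (by omega), hd,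
            Nat.add_sub_cancel]
          by_contra h7
          have := recovered_spec I.mult ch _ a d k c le_rfl (by omega)
          omega
        unfold detourLength
        rw [min_eq_left (by omega), min_eq_left (by omega), sub_self, zero_mul]

end LTSP

/-! ## Reasoning about programs -/

attribute [simp] DP.nA DP.reqA DP.qA DP.fileA DP.xA DP.nleftA DP.posA DP.foundA DP.choiceA DP.endA
  DP.nskipA DP.curBA DP.curKA DP.movesA DP.UA DP.mA DP.ellA DP.sizeA DP.LA DP.SA DP.RA DP.tableA
  DP.outA DP.costA

namespace Mem

variable {V : Type} (μ : Mem V)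

@[simp] theorem setNat_nat (arr : ℕ) (idx : List ℕ) (u : ℕ) (a : ℕ) (i : List ℕ) :
    (μ.setNat arr idx u).nat a i = if a = arr ∧ i = idx then u else μ.nat a i := rfl

@[simp] theorem setNat_val (arr : ℕ) (idx : List ℕ) (u : ℕ) : (μ.setNat arr idx u).val = μ.val := rfl

@[simp] theorem setVal_val (arr : ℕ) (idx : List ℕ) (u : V) (a : ℕ) (i : List ℕ) :
    (μ.setVal arr idx u).val a i = if a = arr ∧ i = idx then u else μ.val a i := rfl

@[simp] theorem setVal_nat (arr : ℕ) (idx : List ℕ) (u : V) : (μ.setVal arr idx u).nat = μ.nat := rfl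

/-- Outside the arrays `A` and `B`, the memories agree. -/
def SameExcept (A B : List ℕ) (μ μ' : Mem V) : Prop :=
  (∀ arr, arr ∉ A → ∀ idx, μ'.nat arr idx = μ.nat arr idx) ∧
  (∀ arr, arr ∉ B → ∀ idx, μ'.val arr idx = μ.val arr idx)

theorem SameExcept.refl (A B : List ℕ) : SameExcept A B μ μ := ⟨fun _ _ _ => rfl, fun _ _ _ => rfl⟩

variable {μ}

theorem SameExcept.trans {A B : List ℕ} {μ' μ'' : Mem V} (h : SameExcept A B μ μ')
    (h' : SameExcept A B μ' μ'') : SameExcept A B μ μ'' :=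
  ⟨fun a ha i => (h'.1 a ha i).trans (h.1 a ha i), fun a ha i => (h'.2 a ha i).trans (h.2 a ha i)⟩

theorem SameExcept.mono {A B A' B' : List ℕ} {μ' : Mem V} (h : SameExcept A B μ μ')
    (hA : A ⊆ A') (hB : B ⊆ B') : SameExcept A' B' μ μ' :=
  ⟨fun a ha => h.1 a fun h' => ha (hA h'), fun a ha => h.2 a fun h' => ha (hB h')⟩

theorem SameExcept.setNat {A B : List ℕ} {μ' : Mem V} (h : SameExcept A B μ μ') {arr : ℕ}
    (ha : arr ∈ A) (idx : List ℕ) (u : ℕ) : SameExcept A B μ (μ'.setNat arr idx u) :=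
  ⟨fun a h' i => by
    rw [setNat_nat, if_neg fun hc : a = arr ∧ i = idx => h' (hc.1 ▸ ha)]
    exact h.1 a h' i, h.2⟩

theorem SameExcept.setVal {A B : List ℕ} {μ' : Mem V} (h : SameExcept A B μ μ') {arr : ℕ}
    (ha : arr ∈ B) (idx : List ℕ) (u : V) : SameExcept A B μ (μ'.setVal arr idx u) :=
  ⟨h.1, fun a h' i => by
    rw [setVal_val, if_neg fun hc : a = arr ∧ i = idx => h' (hc.1 ▸ ha)]
    exact h.2 a h' i⟩

end Mem

namespace Prog

variable {V : Type} [CommRing V] [LinearOrder V]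

/-- The final memory and the number of steps of the program satisfy `Q`. -/
def Spec (p : Prog ℕ V) (μ : Mem V) (Q : Mem V → ℕ → Prop) : Prop := Q (p.run μ).1 (p.run μ).2

variable {μ : Mem V} {Q : Mem V → ℕ → Prop}

theorem Spec.mono {p : Prog ℕ V} {Q' : Mem V → ℕ → Prop} (h : Spec p μ Q)
    (hQ : ∀ μ' t, Q μ' t → Q' μ' t) : Spec p μ Q' := hQ _ _ h

-- These rules move the cost of each instruction into the postcondition, so that `simp` executes
-- straight-line code symbolically.
@[simp] theorem spec_halt : Spec halt μ Q ↔ Q μ 0 := Iff.rfl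
@[simp] theorem spec_seq {p q : Prog ℕ V} : Spec (p ;; q) μ Q ↔
    Spec p μ fun μ' t => Spec q μ' fun μ'' t' => Q μ'' (t + t') := Iff.rfl
@[simp] theorem spec_const {c : ℕ} {k : ℕ → Prog ℕ V} :
    Spec (const c k) μ Q ↔ Spec (k c) μ fun μ' t => Q μ' (t + 1) := Iff.rfl
@[simp] theorem spec_addN {u v : ℕ} {k : ℕ → Prog ℕ V} :
    Spec (addN u v k) μ Q ↔ Spec (k (u + v)) μ fun μ' t => Q μ' (t + 1) := Iff.rfl
@[simp] theorem spec_subN {u v : ℕ} {k : ℕ → Prog ℕ V} :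
    Spec (subN u v k) μ Q ↔ Spec (k (u - v)) μ fun μ' t => Q μ' (t + 1) := Iff.rfl
@[simp] theorem spec_cast {u : ℕ} {k : V → Prog ℕ V} :
    Spec (cast u k) μ Q ↔ Spec (k (u : V)) μ fun μ' t => Q μ' (t + 1) := Iff.rfl
@[simp] theorem spec_addV {u v : V} {k : V → Prog ℕ V} :
    Spec (addV u v k) μ Q ↔ Spec (k (u + v)) μ fun μ' t => Q μ' (t + 1) := Iff.rfl
@[simp] theorem spec_subV {u v : V} {k : V → Prog ℕ V} :
    Spec (subV u v k) μ Q ↔ Spec (k (u - v)) μ fun μ' t => Q μ' (t + 1) := Iff.rfl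
@[simp] theorem spec_mulV {u v : V} {k : V → Prog ℕ V} :
    Spec (mulV u v k) μ Q ↔ Spec (k (u * v)) μ fun μ' t => Q μ' (t + 1) := Iff.rfl
@[simp] theorem spec_loadN {arr : ℕ} {idx : List ℕ} {k : ℕ → Prog ℕ V} :
    Spec (loadN arr idx k) μ Q ↔
      Spec (k (μ.nat arr idx)) μ fun μ' t => Q μ' (t + idx.length + 1) := Iff.rfl
@[simp] theorem spec_storeN {arr : ℕ} {idx : List ℕ} {u : ℕ} :
    Spec (storeN arr idx u) μ Q ↔ Q (μ.setNat arr idx u) (idx.length + 1) := Iff.rfl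
@[simp] theorem spec_loadV {arr : ℕ} {idx : List ℕ} {k : V → Prog ℕ V} :
    Spec (loadV arr idx k) μ Q ↔
      Spec (k (μ.val arr idx)) μ fun μ' t => Q μ' (t + idx.length + 1) := Iff.rfl
@[simp] theorem spec_storeV {arr : ℕ} {idx : List ℕ} {u : V} :
    Spec (storeV arr idx u) μ Q ↔ Q (μ.setVal arr idx u) (idx.length + 1) := Iff.rfl
@[simp] theorem spec_ifLtN {u v : ℕ} {p q : Prog ℕ V} : Spec (ifLtN u v p q) μ Q ↔
    (u < v → Spec p μ fun μ' t => Q μ' (t + 1)) ∧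
    (v ≤ u → Spec q μ fun μ' t => Q μ' (t + 1)) := by
  unfold Spec
  rw [run]
  by_cases h : u < v
  · simp [h]
  · simp [h, not_lt.1 h]
@[simp] theorem spec_ifLtV {u v : V} {p q : Prog ℕ V} : Spec (ifLtV u v p q) μ Q ↔
    (u < v → Spec p μ fun μ' t => Q μ' (t + 1)) ∧
    (v ≤ u → Spec q μ fun μ' t => Q μ' (t + 1)) := by
  unfold Spec
  rw [run]
  by_cases h : u < v
  · simp [h]
  · simp [h, not_lt.1 h]

/-- The rule for loops: `Inv i` holds after `i` iterations, and every iteration takes at most `B`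
steps. -/
theorem spec_loop (Inv : ℕ → Mem V → Prop) (B : ℕ) {u : ℕ} {body : ℕ → Prog ℕ V} (h0 : Inv 0 μ)
    (hs : ∀ i < u, ∀ μ', Inv i μ' → Spec (body i) μ' fun μ'' t => Inv (i + 1) μ'' ∧ t ≤ B)
    (hQ : ∀ μ' t, Inv u μ' → t ≤ 1 + u * (B + 1) → Q μ' t) : Spec (loop u body) μ Q := by
  have key : ∀ v ≤ u, Inv v ((loop v body).run μ).1 ∧ ((loop v body).run μ).2 ≤ 1 + v * (B + 1) := by
    intro v
    induction v with
    | zero => intro _; simpa [run] using h0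
    | succ v ih =>
      intro hv
      obtain ⟨i1, i2⟩ := ih (by omega)
      have := hs v hv _ i1
      simp only [Spec, run] at this i2 ⊢
      rw [List.range_succ, List.foldl_append]
      simp only [List.foldl_cons, List.foldl_nil]
      refine ⟨this.1, ?_⟩
      have h2 := this.2
      rw [Nat.succ_mul]
      omega
  exact hQ _ _ (key u le_rfl).1 (key u le_rfl).2

end Prog

/-! ### Inserting a request into the sorted list -/

namespace DP

open Prog Mem

/-- Here `p` is the number of stored files smaller than `f`; the alternatives are a hit at `p`,
which only increments a counter, and a new entry at `p`, which shifts the tail. -/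
theorem spec_insertReq (μ : Mem ℝ) (f : ℕ)
    (hs : ∀ i j, i < j → j < μ.nat qA [] → μ.nat fileA [i] < μ.nat fileA [j]) :
    Spec (insertReq f) μ fun μ' t => t ≤ 50 + 50 * μ.nat qA [] ∧
      SameExcept [qA, fileA, xA, posA, foundA] [] μ μ' ∧ ∃ p ≤ μ.nat qA [],
        (∀ j < p, μ.nat fileA [j] < f) ∧
        ((p < μ.nat qA [] ∧ μ.nat fileA [p] = f ∧ μ'.nat qA [] = μ.nat qA [] ∧
          (∀ j, μ'.nat fileA [j] = μ.nat fileA [j]) ∧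
          (∀ j, μ'.nat xA [j] = μ.nat xA [j] + if j = p then 1 else 0)) ∨
         ((∀ j, p ≤ j → j < μ.nat qA [] → f < μ.nat fileA [j]) ∧
          μ'.nat qA [] = μ.nat qA [] + 1 ∧ μ'.nat fileA [p] = f ∧ μ'.nat xA [p] = 1 ∧
          (∀ j < p, μ'.nat fileA [j] = μ.nat fileA [j] ∧ μ'.nat xA [j] = μ.nat xA [j]) ∧
          (∀ j, p ≤ j → j < μ.nat qA [] →
            μ'.nat fileA [j + 1] = μ.nat fileA [j] ∧ μ'.nat xA [j + 1] = μ.nat xA [j]))) := by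
  simp only [insertReq, spec_const, spec_seq, spec_storeN, spec_loadN]
  simp only [qA, fileA] at hs
  set μ0 := (μ.setNat posA [] 0).setNat foundA [] 0 with hμ0
  have hq : μ0.nat 2 [] = μ.nat 2 [] := by simp [hμ0]
  refine spec_loop (fun i μ' => SameExcept [4, 6, 7] [] μ μ' ∧ μ'.nat 6 [] ≤ i ∧
    (∀ j < μ'.nat 6 [], μ.nat 3 [j] < f) ∧
    (∀ j, μ'.nat 6 [] ≤ j → j < i → f ≤ μ.nat 3 [j]) ∧
    ((μ'.nat 7 [] = 0 ∧ (∀ j < i, μ.nat 3 [j] ≠ f) ∧ ∀ j, μ'.nat 4 [j] = μ.nat 4 [j]) ∨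
     (μ'.nat 7 [] = 1 ∧ μ'.nat 6 [] < i ∧ μ.nat 3 [μ'.nat 6 []] = f ∧
      ∀ j, μ'.nat 4 [j] = μ.nat 4 [j] + if j = μ'.nat 6 [] then 1 else 0))) 20 ?_ ?_ ?_
  · refine ⟨((SameExcept.refl _ _ _).setNat (by simp) _ _).setNat (by simp) _ _, ?_⟩
    simp [hμ0]
  · rintro i hi μ' ⟨hfr, h1, h2, h3, h4⟩
    rw [hq] at hi
    have hF : ∀ j, μ'.nat 3 [j] = μ.nat 3 [j] := fun j => hfr.1 3 (by simp) _
    -- By sortedness, an entry at most `f` is preceded only by entries below `f`, all of which have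
    -- been counted.
    have hp : μ.nat 3 [i] ≤ f → μ'.nat 6 [] = i := by
      intro h
      by_contra hc
      have i1 := h3 _ le_rfl (by omega)
      have i2 := hs (μ'.nat 6 []) i (by omega) hi
      omega
    simp only [spec_loadN, spec_ifLtN, spec_addN, spec_storeN, spec_halt, spec_seq, fileA, posA,
      foundA, xA, hF]
    refine ⟨fun h => ?_, fun h => ⟨fun h' => ?_, fun h' => ?_⟩⟩
    · have hpi := hp h.le
      refine ⟨⟨hfr.setNat (by simp) _ _, ?_⟩, by simp⟩
      simp only [setNat_nat, true_and, if_true, hpi]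
      refine ⟨by omega, fun j hj => ?_, fun j h5 h6 => by omega, ?_⟩
      · rcases (by omega : j < i ∨ j = i) with h' | rfl
        · exact h2 j (by omega)
        · exact h
      · rcases h4 with ⟨h4, h5, h6⟩ | ⟨_, h5, _⟩
        · refine Or.inl ⟨by simpa using h4, fun j hj => ?_, by simpa using h6⟩
          rcases (by omega : j < i ∨ j = i) with h' | rfl
          · exact h5 j h'
          · exact h.ne
        · omega
    · refine ⟨⟨hfr, by omega, h2, fun j h5 h6 => ?_, ?_⟩, by simp⟩
      · rcases (by omega : j < i ∨ j = i) with h'' | rfl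
        · exact h3 j h5 h''
        · exact h
      · rcases h4 with ⟨h4, h5, h6⟩ | ⟨h4, h5, h6⟩
        · refine Or.inl ⟨h4, fun j hj => ?_, h6⟩
          rcases (by omega : j < i ∨ j = i) with h'' | rfl
          · exact h5 j h''
          · exact h'.ne'
        · exact Or.inr ⟨h4, by omega, h6⟩
    · have hpi := hp h'
      refine ⟨⟨(hfr.setNat (by simp) _ _).setNat (by simp) _ _, ?_⟩, by simp⟩
      simp only [setNat_nat, hpi]
      norm_num
      refine ⟨fun j hj => h2 j (by omega), fun j h5 h6 => ?_, by omega, fun j => ?_⟩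
      · obtain rfl : j = i := by omega
        exact h
      · rcases h4 with ⟨_, _, h6⟩ | ⟨_, h5, _⟩
        · simp only [h6]
          split_ifs with hj
          · rw [hj]
          · rfl
        · omega
  · rintro μ' t ⟨hfr, h1, h2, h3, h4⟩ ht
    rw [hq] at h1 h3 h4 ht ⊢
    simp only [qA, fileA, xA, posA, foundA, spec_ifLtN, spec_loadN, spec_subN, spec_seq, spec_storeN,
      spec_addN, spec_halt]
    set q := μ.nat 2 [] with hqd
    set p := μ'.nat 6 [] with hpd
    have hF : ∀ j, μ'.nat 3 [j] = μ.nat 3 [j] := fun j => hfr.1 3 (by simp) _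
    have hsub : [4, 6, 7] ⊆ [2, 3, 4, 6, 7] := by simp
    refine ⟨fun hfound => ?_, fun hfound => ?_⟩
    · rcases h4 with ⟨_, h5, h6⟩ | ⟨h4, _⟩
      swap
      · omega
      -- The shift runs from the right, so each source is read before it is overwritten: after `i`
      -- iterations exactly the positions in `(q - i, q]` are shifted.
      refine spec_loop (fun i μ'' => SameExcept [3, 4] [] μ' μ'' ∧
        (∀ j, μ''.nat 3 [j] = if q - i < j ∧ j ≤ q then μ.nat 3 [j - 1] else μ.nat 3 [j]) ∧
        (∀ j, μ''.nat 4 [j] = if q - i < j ∧ j ≤ q then μ.nat 4 [j - 1] else μ.nat 4 [j]))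
        20 ?_ ?_ ?_
      · refine ⟨SameExcept.refl _ _ _, fun j => ?_, fun j => ?_⟩
        · rw [if_neg (by omega), hF]
        · rw [if_neg (by omega), h6]
      · rintro i hi μ'' ⟨g1, g2, g3⟩
        simp only [spec_loadN, spec_subN, spec_seq, spec_storeN]
        refine ⟨⟨(g1.setNat (by simp) _ _).setNat (by simp) _ _, fun j => ?_, fun j => ?_⟩, by simp⟩
        · simp only [setNat_nat, g2]
          norm_num
          split_ifs with a1 a2 a3 a4 <;> first | rfl | omega | (subst a1; rfl)
        · simp only [setNat_nat, g3]
          norm_num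
          split_ifs with a1 a2 a3 a4 <;> first | rfl | omega | (subst a1; rfl)
      · rintro μ'' t' ⟨g1, g2, g3⟩ ht'
        rw [Nat.sub_sub_self h1] at g2 g3
        have hb : (q - p) * (20 + 1) ≤ q * (20 + 1) := Nat.mul_le_mul_right _ (by omega)
        refine ⟨by simp only [List.length_nil, List.length_cons]; omega, ?_, p, h1, h2, Or.inr ?_⟩
        · exact (((hfr.mono hsub (by simp)).trans (g1.mono (by simp) (by simp))).setNat
            (by simp) _ _ |>.setNat (by simp) _ _).setNat (by simp) _ _
        · simp only [setNat_nat]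
          norm_num
          refine ⟨fun j h7 h8 => ?_, fun j hj => ?_, fun j h7 h8 => ?_⟩
          · exact lt_of_le_of_ne (h3 j h7 h8) (h5 j h8).symm
          · rw [if_neg (by omega), if_neg (by omega), g2, g3, if_neg (by omega), if_neg (by omega)]
            exact ⟨rfl, rfl⟩
          · rw [if_neg (by omega), if_neg (by omega), g2, g3, if_pos (by omega), if_pos (by omega)]
            exact ⟨rfl, rfl⟩
    · rcases h4 with ⟨h4, _⟩ | ⟨_, h5, h6, h7⟩
      · omega
      refine ⟨by simp only [List.length_nil]; omega, hfr.mono hsub (by simp), p, h1, h2, Or.inl ?_⟩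
      exact ⟨h5, h6, hfr.1 2 (by simp) _, hF, h7⟩

end DP

/-! ### Sorting the requests and preparing the file data -/

namespace DP

open Prog Mem

variable (I : LTSP)

/-- The first `i` requests have been sorted and counted. -/
structure Collected (i : ℕ) (μ : Mem ℝ) : Prop where
  same : SameExcept [2, 3, 4, 6, 7] [] I.initMem μ
  mono : ∀ a b, a < b → b < μ.nat 2 [] → μ.nat 3 [a] < μ.nat 3 [b]
  mem : ∀ f, (∃ j < μ.nat 2 [], μ.nat 3 [j] = f) ↔ ∃ i' < i, I.req i' = f
  count : ∀ j < μ.nat 2 [],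
    μ.nat 4 [j] = ((Finset.range i).filter fun i' => I.req i' = μ.nat 3 [j]).card

variable {I}

/-- This keeps the cost of one insertion linear in `nreq` rather than in `n`. -/
theorem Collected.le_nreq {i : ℕ} {μ : Mem ℝ} (h : Collected I i μ) (hi : i ≤ I.n) :
    μ.nat 2 [] ≤ I.nreq := by
  rw [LTSP.nreq, ← Finset.card_range (μ.nat 2 [])]
  refine Finset.card_le_card_of_injOn (fun j => μ.nat 3 [j]) (fun j hj => ?_) fun a ha b hb hab => ?_
  · obtain ⟨i', hi', he⟩ := (h.mem _).1 ⟨j, by simpa using hj, rfl⟩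
    exact Finset.mem_coe.2 (Finset.mem_image.2 ⟨i', Finset.mem_range.2 (by omega), he⟩)
  · simp only [Finset.coe_range, Set.mem_Iio] at ha hb hab
    rcases lt_trichotomy a b with h' | h' | h'
    · exact absurd hab (h.mono a b h' hb).ne
    · exact h'
    · exact absurd hab (h.mono b a h' ha).ne'

theorem card_requests_succ (i f : ℕ) :
    ((Finset.range (i + 1)).filter fun i' => I.req i' = f).card =
      ((Finset.range i).filter fun i' => I.req i' = f).card + if I.req i = f then 1 else 0 := by
  rw [Finset.range_add_one, Finset.filter_insert]
  split_ifs
  · rw [Finset.card_insert_of_notMem (by simp)]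
  · rfl

theorem Collected.insertReq {i : ℕ} {μ : Mem ℝ} (h : Collected I i μ) (hi : i < I.n) :
    Spec (insertReq (I.req i)) μ fun μ' t => Collected I (i + 1) μ' ∧ t ≤ 50 + 50 * I.nreq := by
  have hq := h.le_nreq hi.le
  refine (spec_insertReq μ (I.req i) h.mono).mono ?_
  simp only [qA, fileA, xA, posA, foundA]
  rintro μ' t ⟨ht, hsame, p, hp, hlt, hcase⟩
  refine ⟨?_, by omega⟩
  have hS : SameExcept [2, 3, 4, 6, 7] [] I.initMem μ' := h.same.trans hsame
  rcases hcase with ⟨h1, h2, h3, h4, h5⟩ | ⟨h1, h2, h3, h4, h5, h6⟩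
  · refine ⟨hS, fun a b hab hb => ?_, fun f => ?_, fun j hj => ?_⟩
    · rw [h4, h4]
      exact h.mono a b hab (h3 ▸ hb)
    · simp only [h3, h4, h.mem f, Nat.lt_succ_iff_lt_or_eq, or_and_right, exists_or, exists_eq_left]
      refine ⟨Or.inl, fun h' => h'.elim id fun h' => ?_⟩
      exact (h.mem f).1 ⟨p, h1, h2.trans h'⟩
    · rw [h3] at hj
      rw [h5, h4, card_requests_succ, h.count j hj]
      congr 1
      rcases lt_trichotomy j p with h' | h' | h'
      · have := h.mono j p h' h1
        rw [if_neg (by omega), if_neg (by omega)]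
      · rw [if_pos h', if_pos (by rw [h', h2])]
      · have := h.mono p j h' hj
        rw [if_neg (by omega), if_neg (by omega)]
  · have hnew : ((Finset.range i).filter fun i' => I.req i' = I.req i).card = 0 := by
      rw [Finset.card_eq_zero, Finset.filter_eq_empty_iff]
      intro i' hi' he
      obtain ⟨j, hj, hf⟩ := (h.mem _).2 ⟨i', by simpa using hi', he⟩
      rcases lt_or_ge j p with h' | h'
      · exact absurd hf (hlt j h').ne
      · exact absurd hf (h1 j h' hj).ne'
    refine ⟨hS, fun a b hab hb => ?_, fun f => ?_, fun j hj => ?_⟩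
    · rw [h2] at hb
      rcases lt_trichotomy b p with hbp | rfl | hbp
      · rw [(h5 a (by omega)).1, (h5 b hbp).1]
        exact h.mono a b hab (by omega)
      · rw [(h5 a hab).1, h3]
        exact hlt a hab
      · obtain ⟨b, rfl⟩ : ∃ d, b = d + 1 := ⟨b - 1, by omega⟩
        rw [(h6 b (by omega) (by omega)).1]
        rcases lt_trichotomy a p with hap | rfl | hap
        · rw [(h5 a hap).1]
          exact h.mono a b (by omega) (by omega)
        · rw [h3]
          exact h1 b (by omega) (by omega)
        · obtain ⟨a, rfl⟩ : ∃ d, a = d + 1 := ⟨a - 1, by omega⟩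
          rw [(h6 a (by omega) (by omega)).1]
          exact h.mono a b (by omega) (by omega)
    · simp only [Nat.lt_succ_iff_lt_or_eq, or_and_right, exists_or, exists_eq_left, ← h.mem f]
      constructor
      · rintro ⟨j, hj, rfl⟩
        rw [h2] at hj
        rcases lt_trichotomy j p with h' | rfl | h'
        · exact Or.inl ⟨j, by omega, (h5 j h').1.symm⟩
        · exact Or.inr h3.symm
        · obtain ⟨j, rfl⟩ : ∃ d, j = d + 1 := ⟨j - 1, by omega⟩
          exact Or.inl ⟨j, by omega, (h6 j (by omega) (by omega)).1.symm⟩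
      · rintro (⟨j, hj, rfl⟩ | rfl)
        · rcases lt_or_ge j p with h' | h'
          · exact ⟨j, by omega, (h5 j h').1⟩
          · exact ⟨j + 1, by omega, (h6 j h' hj).1⟩
        · exact ⟨p, by omega, h3⟩
    · rw [h2] at hj
      rw [card_requests_succ]
      rcases lt_trichotomy j p with h' | rfl | h'
      · rw [(h5 j h').1, (h5 j h').2, h.count j (by omega), if_neg (hlt j h').ne']
        rfl
      · rw [h4, h3, hnew, if_pos rfl]
      · obtain ⟨j, rfl⟩ : ∃ d, j = d + 1 := ⟨j - 1, by omega⟩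
        have h7 := h6 j (by omega) (by omega)
        rw [h7.1, h7.2, h.count j (by omega), if_neg (h1 j (by omega) (by omega)).ne]
        rfl

variable (I)

/-- The data of the requested files are stored in the memory. -/
structure Prepared (μ : Mem ℝ) : Prop where
  n : μ.nat 0 [] = I.n
  q : μ.nat 2 [] = I.nreq
  x : ∀ j < I.nreq, μ.nat 4 [j] = I.mult j
  nleft : ∀ j ≤ I.nreq, μ.nat 5 [j] = I.before j
  penalty : μ.val 0 [] = I.U
  m : μ.val 1 [] = I.m
  l : ∀ j < I.nreq, μ.val 4 [j] = I.lpos j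
  s : ∀ j < I.nreq, μ.val 5 [j] = I.s (I.file j)
  r : ∀ j < I.nreq, μ.val 6 [j] = I.rpos j

variable {I}

/-- The arrays are numbered so that all later phases write only at or above these two thresholds. -/
theorem Prepared.of_same {A B : List ℕ} {μ μ' : Mem ℝ} (h : Prepared I μ)
    (hs : SameExcept A B μ μ') (hA : ∀ a ∈ A, 8 ≤ a) (hB : ∀ a ∈ B, 7 ≤ a) : Prepared I μ' := by
  have h1 : ∀ a < 8, ∀ i, μ'.nat a i = μ.nat a i := fun a ha =>
    hs.1 a fun h' => absurd (hA a h') (by omega)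
  have h2 : ∀ a < 7, ∀ i, μ'.val a i = μ.val a i := fun a ha =>
    hs.2 a fun h' => absurd (hB a h') (by omega)
  constructor
  · rw [h1 _ (by norm_num), h.n]
  · rw [h1 _ (by norm_num), h.q]
  · intro j hj
    rw [h1 _ (by norm_num), h.x j hj]
  · intro j hj
    rw [h1 _ (by norm_num), h.nleft j hj]
  · rw [h2 _ (by norm_num), h.penalty]
  · rw [h2 _ (by norm_num), h.m]
  · intro j hj
    rw [h2 _ (by norm_num), h.l j hj]
  · intro j hj
    rw [h2 _ (by norm_num), h.s j hj]
  · intro j hj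
    rw [h2 _ (by norm_num), h.r j hj]

theorem spec_prepare : Spec (prepare : Prog ℕ ℝ) I.initMem fun μ t =>
    Prepared I μ ∧ (∀ idx, μ.nat endA idx = 0) ∧
      t ≤ 100 * (I.nreq * I.n) + 100 * I.n + 100 * I.nreq + 100 := by
  simp only [prepare, spec_const, spec_seq, spec_storeN, spec_loadN]
  simp only [nA, qA, reqA, fileA, xA, nleftA, endA, ellA, sizeA, LA, SA, RA]
  have hn : (I.initMem.setNat 2 [] 0).nat 0 [] = I.n := by simp [LTSP.initMem]
  rw [hn]
  refine spec_loop (Collected I) (60 + 50 * I.nreq) ⟨?_, ?_, ?_, ?_⟩ ?_ ?_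
  · exact (SameExcept.refl _ _ _).setNat (by simp) _ _
  · simp
  · simp
  · simp
  · intro i hi μ hμ
    have hreq : μ.nat 1 [i] = I.req i := by
      rw [hμ.same.1 1 (by simp)]
      simp [LTSP.initMem, hi]
    rw [spec_loadN, hreq]
    refine (hμ.insertReq hi).mono fun μ' t ⟨h1, h2⟩ => ⟨h1, ?_⟩
    simp only [List.length_cons, List.length_nil]
    omega
  · intro μ t hμ ht
    obtain ⟨hq, hfile⟩ := I.file_eq_of_sorted hμ.mono (fun f => by
      rw [hμ.mem f]
      simp [LTSP.requested])
    have hx : ∀ j < I.nreq, μ.nat 4 [j] = I.mult j := fun j hj => by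
      rw [hμ.count j (by omega), hfile j (by omega)]
      rfl
    rw [hq] at hfile
    have hq' : (μ.setNat 5 [0] 0).nat 2 [] = I.nreq := by simp [hq]
    rw [hq']
    refine spec_loop (fun i μ' => SameExcept [5] [4, 5, 6] μ μ' ∧
      (∀ j ≤ i, μ'.nat 5 [j] = I.before j) ∧ ∀ j < i, μ'.val 4 [j] = I.lpos j ∧
        μ'.val 5 [j] = I.s (I.file j) ∧ μ'.val 6 [j] = I.rpos j) 40 ?_ ?_ ?_
    · refine ⟨(SameExcept.refl _ _ _).setNat (by simp) _ _, ?_, ?_⟩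
      · intro j hj
        obtain rfl : j = 0 := by omega
        simp [LTSP.before]
      · intro j hj
        omega
    · rintro i hi μ' ⟨h1, h2, h3⟩
      have e1 : μ'.nat 3 [i] = I.file i := (h1.1 3 (by simp) _).trans (hfile i hi)
      have e2 : μ'.nat 4 [i] = I.mult i := (h1.1 4 (by simp) _).trans (hx i hi)
      have hf := I.file_lt_nf hi
      have e3 : μ'.val 2 [I.file i] = I.lpos i := by
        rw [h1.2 2 (by simp), hμ.same.2 2 (by simp)]
        simp [LTSP.initMem, hf, LTSP.lpos]
      have e4 : μ'.val 3 [I.file i] = I.s (I.file i) := by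
        rw [h1.2 3 (by simp), hμ.same.2 3 (by simp)]
        simp [LTSP.initMem, hf]
      simp only [spec_loadN, spec_addN, spec_storeN, spec_loadV, spec_storeV, spec_addV, spec_seq]
      refine ⟨⟨?_, ?_, ?_⟩, by simp⟩
      · exact (((h1.setNat (by simp) _ _).setVal (by simp) _ _).setVal (by simp) _ _).setVal
          (by simp) _ _
      · intro j hj
        simp only [setVal_nat, setNat_nat, true_and, List.cons.injEq, and_true]
        split_ifs with hji
        · rw [hji, I.before_succ, h2 i le_rfl, e2]
        · exact h2 j (by omega)
      · intro j hj
        simp [e1, e3, e4]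
        split_ifs with hji
        · rw [hji, I.rpos_eq]
          exact ⟨rfl, rfl, rfl⟩
        · exact h3 j (by omega)
    · rintro μ' t' ⟨h1, h2, h3⟩ ht'
      refine ⟨⟨?_, ?_, ?_, h2, ?_, ?_, fun j hj => (h3 j hj).1, fun j hj => (h3 j hj).2.1,
        fun j hj => (h3 j hj).2.2⟩, ?_, ?_⟩
      · rw [h1.1 0 (by simp), hμ.same.1 0 (by simp)]
        simp [LTSP.initMem]
      · rw [h1.1 2 (by simp), hq]
      · intro j hj
        rw [h1.1 4 (by simp), hx j hj]
      · rw [h1.2 0 (by simp), hμ.same.2 0 (by simp)]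
        simp [LTSP.initMem]
      · rw [h1.2 1 (by simp), hμ.same.2 1 (by simp)]
        simp [LTSP.initMem]
      · intro idx
        rw [h1.1 9 (by simp), hμ.same.1 9 (by simp)]
        simp [LTSP.initMem]
      · simp only [List.length_nil, List.length_cons]
        have : I.n * (60 + 50 * I.nreq + 1) = 61 * I.n + 50 * (I.nreq * I.n) := by ring
        omega

end DP

/-! ### Filling the table -/

namespace DP

open Prog Mem

variable (I : LTSP)

/-- The cell `[a, b, k]` and its choice have been computed. -/
def CellDone (μ : Mem ℝ) (a b k : ℕ) : Prop :=
  μ.val 7 [a, b, k] = I.cell a b k ∧ (a < b →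
    (μ.nat 8 [a, b, k] = 0 ∧ I.cell a b k = I.skipValue a b k) ∨
    (a < μ.nat 8 [a, b, k] ∧ μ.nat 8 [a, b, k] ≤ b ∧
      I.cell a b k = I.detourValue a b k (μ.nat 8 [a, b, k])))

/-- The memories agree except for the cell `[a, b, k]`. -/
def SameExceptCell (a b k : ℕ) (μ μ' : Mem ℝ) : Prop :=
  SameExcept [8] [7] μ μ' ∧ ∀ idx, idx ≠ [a, b, k] →
    μ'.nat 8 idx = μ.nat 8 idx ∧ μ'.val 7 idx = μ.val 7 idx

variable {I} {μ : Mem ℝ} {a b k : ℕ}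

theorem SameExceptCell.refl : SameExceptCell a b k μ μ :=
  ⟨SameExcept.refl _ _ _, fun _ _ => ⟨rfl, rfl⟩⟩

theorem SameExceptCell.setChoice {μ' : Mem ℝ} (h : SameExceptCell a b k μ μ') (u : ℕ) :
    SameExceptCell a b k μ (μ'.setNat 8 [a, b, k] u) :=
  ⟨h.1.setNat (by simp) _ _, fun idx hi => ⟨by
    rw [setNat_nat, if_neg (fun hc => hi hc.2)]
    exact (h.2 idx hi).1, (h.2 idx hi).2⟩⟩

theorem SameExceptCell.setTable {μ' : Mem ℝ} (h : SameExceptCell a b k μ μ') (u : ℝ) :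
    SameExceptCell a b k μ (μ'.setVal 7 [a, b, k] u) :=
  ⟨h.1.setVal (by simp) _ _, fun idx hi => ⟨(h.2 idx hi).1, by
    rw [setVal_val, if_neg (fun hc => hi hc.2)]
    exact (h.2 idx hi).2⟩⟩

theorem CellDone.of_same {a' b' k' : ℕ} {μ' : Mem ℝ} (h : CellDone I μ a' b' k')
    (hs : SameExceptCell a b k μ μ') (hne : [a', b', k'] ≠ [a, b, k]) :
    CellDone I μ' a' b' k' := by
  unfold CellDone
  rw [(hs.2 _ hne).1, (hs.2 _ hne).2]
  exact h

theorem spec_baseCell (hμ : Prepared I μ) (hb : b < I.nreq) :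
    Spec (baseCell b k) μ fun μ' t => SameExceptCell b b k μ μ' ∧ CellDone I μ' b b k ∧ t ≤ 30 := by
  simp only [baseCell, spec_loadN, spec_addN, spec_cast, spec_loadV, spec_addV, spec_mulV,
    spec_storeV, nleftA, SA, tableA, hμ.nleft b hb.le, hμ.s b hb]
  refine ⟨SameExceptCell.refl.setTable _, ⟨?_, fun h => absurd h (lt_irrefl _)⟩, by simp⟩
  rw [I.cell_self hb, I.rpos_eq]
  simp only [setVal_val, true_and, if_true]
  push_cast
  ring

theorem spec_recCell (hμ : Prepared I μ) (hab : a < b) (hb : b < I.nreq)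
    (hk : k + I.before (b + 1) ≤ I.n)
    (hdone : ∀ a' b' k', a' ≤ b' → b' < I.nreq → b' - a' < b - a → k' + I.before (b' + 1) ≤ I.n →
      CellDone I μ a' b' k') :
    Spec (recCell (b - a) a b k) μ fun μ' t =>
      SameExceptCell a b k μ μ' ∧ CellDone I μ' a b k ∧ t ≤ 50 + 50 * (b - a) := by
  have hbs : I.before (b + 1) = I.before b + I.mult b := I.before_succ b
  -- Skipping `b` raises `k` by just the amount by which the permitted range grows from `b` to `b -
  -- 1`.
  have hskip := (hdone a (b - 1) (k + I.mult b) (by omega) (by omega) (by omega) (by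
    rw [Nat.sub_add_cancel (by omega)]
    omega)).1
  simp only [recCell, spec_const, spec_loadN, spec_addN, spec_cast, spec_loadV, spec_addV, spec_mulV,
    spec_subN, spec_subV, spec_storeV, spec_storeN, spec_seq]
  simp only [nleftA, RA, xA, tableA, LA, choiceA, UA,
    hμ.nleft a (by omega), hμ.r b hb, hμ.x b hb, hμ.l b hb, hμ.r (b - 1) (by omega), hskip]
  set μ0 := (μ.setVal 7 [a, b, k] (I.cell a (b - 1) (k + I.mult b) +
    (I.rpos b - I.rpos (b - 1) + (I.rpos b - I.rpos (b - 1))) * ((k + I.before a : ℕ) : ℝ) +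
    (I.lpos b - I.rpos (b - 1) + (I.lpos b - I.rpos (b - 1))) * (I.mult b : ℝ))).setNat 8
    [a, b, k] 0 with hμ0
  -- Running minimum: the stored value bounds all candidates tried so far from below and is attained
  -- by the stored choice.
  refine spec_loop (fun i μ' => SameExceptCell a b k μ μ' ∧
    μ'.val 7 [a, b, k] ≤ I.skipValue a b k ∧
    (∀ c, a < c → c ≤ a + i → μ'.val 7 [a, b, k] ≤ I.detourValue a b k c) ∧
    ((μ'.nat 8 [a, b, k] = 0 ∧ μ'.val 7 [a, b, k] = I.skipValue a b k) ∨
     (a < μ'.nat 8 [a, b, k] ∧ μ'.nat 8 [a, b, k] ≤ a + i ∧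
      μ'.val 7 [a, b, k] = I.detourValue a b k (μ'.nat 8 [a, b, k])))) 48 ?_ ?_ ?_
  · have h0 : μ0.val 7 [a, b, k] = I.skipValue a b k := by
      simp only [hμ0, setNat_val, setVal_val, true_and, if_true, LTSP.skipValue]
      push_cast
      ring
    refine ⟨(SameExceptCell.refl.setTable _).setChoice _, h0.le, fun c _ _ => by omega,
      Or.inl ⟨by simp [hμ0], h0⟩⟩
  · rintro i hi μ' ⟨h1, h2, h3, h4⟩
    have hP : Prepared I μ' := hμ.of_same h1.1 (by simp) (by simp)
    have hl := (hdone a (a + i) k (by omega) (by omega) (by omega)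
      ((Nat.add_le_add_left (I.before_mono (by omega)) k).trans hk)).1
    have hr := (hdone (a + i + 1) b k (by omega) hb (by omega) hk).1
    rw [← (h1.2 _ (by simp; omega)).2] at hl hr
    simp only [spec_loadN, spec_addN, spec_cast, spec_loadV, spec_addV, spec_mulV, spec_subV]
    simp only [hP.nleft (a + i + 1) (by omega), hP.r (a + i) (by omega), hP.penalty, hl, hr]
    have hnew : I.cell a (a + i) k + I.cell (a + i + 1) b k +
        (I.rpos b - I.rpos (a + i) + (I.rpos b - I.rpos (a + i))) * ((k + I.before a : ℕ) : ℝ) +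
        (I.U + I.U) * ((k + I.before (a + i + 1) : ℕ) : ℝ)
        = I.detourValue a b k (a + i + 1) := by
      rw [LTSP.detourValue, Nat.add_sub_cancel]
      push_cast
      ring
    simp only [hnew, spec_ifLtV, spec_seq, spec_storeV, spec_storeN, spec_halt]
    refine ⟨fun h => ?_, fun h => ⟨⟨h1, h2, fun c h5 h6 => ?_, ?_⟩, by simp⟩⟩
    · refine ⟨⟨(h1.setTable _).setChoice _, ?_⟩, by simp⟩
      simp only [setNat_val, setVal_val, setNat_nat, true_and, if_true]
      refine ⟨h.le.trans h2, fun c h5 h6 => ?_, Or.inr ⟨by omega, by omega, trivial⟩⟩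
      rcases (by omega : c ≤ a + i ∨ c = a + i + 1) with h' | rfl
      · exact h.le.trans (h3 c h5 h')
      · rfl
    · rcases (by omega : c ≤ a + i ∨ c = a + i + 1) with h' | rfl
      · exact h3 c h5 h'
      · exact h
    · rcases h4 with h4 | ⟨h4, h5, h6⟩
      · exact Or.inl h4
      · exact Or.inr ⟨h4, by omega, h6⟩
  · rintro μ' t ⟨h1, h2, h3, h4⟩ ht
    have hcell : μ'.val 7 [a, b, k] = I.cell a b k := by
      refine le_antisymm (I.le_cell hab hb h2 fun c h5 h6 => h3 c h5 (by omega)) ?_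
      rcases h4 with ⟨_, h4⟩ | ⟨h4, h5, h6⟩
      · exact h4 ▸ I.cell_le_skipValue hab hb k
      · exact h6 ▸ I.cell_le_detourValue h4 (by omega) hb k
    refine ⟨h1, ⟨hcell, fun _ => ?_⟩, ?_⟩
    · rw [← hcell]
      rcases h4 with h4 | ⟨h4, h5, h6⟩
      · exact Or.inl h4
      · exact Or.inr ⟨h4, by omega, h6⟩
    · simp only [List.length_cons, List.length_nil]
      omega

theorem spec_fillTable (hμ : Prepared I μ) : Spec (fillTable : Prog ℕ ℝ) μ fun μ' t =>
    SameExcept [8] [7] μ μ' ∧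
    (∀ a b k, a ≤ b → b < I.nreq → k + I.before (b + 1) ≤ I.n → CellDone I μ' a b k) ∧
    t ≤ 500 * (I.nreq ^ 3 * I.n) := by
  have hq := I.nreq_pos
  have hn := I.n_pos
  simp only [fillTable, spec_const, spec_loadN, nA, qA, hμ.n, hμ.q]
  -- One invariant serves all three loops: the finished cells are those lexicographically below `(d,
  -- a₀, k₀)` in `(b - a, a, k)`.
  set Inv : ℕ → ℕ → ℕ → Mem ℝ → Prop := fun d a₀ k₀ μ' => SameExcept [8] [7] μ μ' ∧
    ∀ a b k, a ≤ b → b < I.nreq → k + I.before (b + 1) ≤ I.n →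
      (b - a < d ∨ b - a = d ∧ (a < a₀ ∨ a = a₀ ∧ k < k₀)) → CellDone I μ' a b k with hInv
  refine spec_loop (fun d => Inv d 0 0) (270 * (I.nreq ^ 2 * I.n)) ?_ ?_ ?_
  · exact ⟨SameExcept.refl _ _ _, fun a b k _ _ _ h => by omega⟩
  · intro d hd μ1 h1
    simp only [spec_subN]
    refine spec_loop (fun a => Inv d a 0) (262 * (I.nreq * I.n)) h1 ?_ ?_
    · intro a ha μ2 h2
      have hP : Prepared I μ2 := hμ.of_same h2.1 (by simp) (by simp)
      have hab : a + d < I.nreq := by omega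
      simp only [spec_addN, spec_loadN, nleftA, spec_subN, hP.nleft (a + d + 1) hab]
      refine spec_loop (fun k => Inv d a k) (102 * I.nreq) h2 ?_ ?_
      · intro k hk μ3 h3
        have hP : Prepared I μ3 := hμ.of_same h3.1 (by simp) (by simp)
        have hkn : k + I.before (a + d + 1) ≤ I.n := by
          have := I.before_le_n (j := a + d + 1) hab
          omega
        have key : Spec (ifLtN 0 d (recCell d a (a + d) k) (baseCell (a + d) k)) μ3 fun μ' t =>
            SameExceptCell a (a + d) k μ3 μ' ∧ CellDone I μ' a (a + d) k ∧ t ≤ 102 * I.nreq := by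
          rw [spec_ifLtN]
          refine ⟨fun hd0 => ?_, fun hd0 => ?_⟩
          · have := spec_recCell (a := a) (b := a + d) (k := k) hP (by omega) hab hkn
              fun a' b' k' i1 i2 i3 i4 => h3.2 a' b' k' i1 i2 i4 (by omega)
            rw [Nat.add_sub_cancel_left] at this
            exact this.mono fun μ' t ⟨i1, i2, i3⟩ => ⟨i1, i2, by omega⟩
          · obtain rfl : d = 0 := by omega
            exact (spec_baseCell hP hab).mono fun μ' t ⟨i1, i2, i3⟩ => ⟨i1, i2, by omega⟩
        refine key.mono fun μ' t ⟨i1, i2, i3⟩ => ⟨⟨h3.1.trans i1.1, ?_⟩, i3⟩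
        intro a' b' k' j1 j2 j3 j4
        by_cases he : [a', b', k'] = [a, a + d, k]
        · simp only [List.cons.injEq, and_true] at he
          obtain ⟨rfl, rfl, rfl⟩ := he
          exact i2
        · refine (h3.2 a' b' k' j1 j2 j3 ?_).of_same i1 he
          simp only [List.cons.injEq, and_true, not_and] at he
          by_contra hc
          have e1 : a' = a := by omega
          have e2 : b' = a + d := by omega
          have := he e1 e2
          omega
      · intro μ' t h3 ht
        refine ⟨⟨h3.1, fun a' b' k' i1 i2 i3 i4 => h3.2 a' b' k' i1 i2 i3 ?_⟩, ?_⟩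
        · rcases i4 with i4 | ⟨i4, i5 | ⟨i5, i6⟩⟩
          · exact Or.inl i4
          · rcases (by omega : a' < a ∨ a' = a) with h' | rfl
            · exact Or.inr ⟨i4, Or.inl h'⟩
            · obtain rfl : b' = a' + d := by omega
              exact Or.inr ⟨i4, Or.inr ⟨rfl, by omega⟩⟩
          · omega
        · simp only [List.length_cons, List.length_nil]
          -- The extra value `k = 0` is absorbed by `n + 1 ≤ 2 * n`, as there is at least one
          -- request.
          have e1 : (I.n - I.before (a + d + 1) + 1) * (102 * I.nreq + 1)
              ≤ (2 * I.n) * (103 * I.nreq) := Nat.mul_le_mul (by omega) (by omega)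
          have e2 : 1 ≤ I.nreq * I.n := Nat.mul_pos hq hn
          have e3 : (2 * I.n) * (103 * I.nreq) = 206 * (I.nreq * I.n) := by ring
          omega
    · intro μ' t h2 ht
      refine ⟨⟨h2.1, fun a' b' k' i1 i2 i3 i4 => h2.2 a' b' k' i1 i2 i3 ?_⟩, ?_⟩
      · omega
      · have e2 : 1 ≤ I.nreq * I.n := Nat.mul_pos hq hn
        have e1 : (I.nreq - d) * (262 * (I.nreq * I.n) + 1) ≤ I.nreq * (263 * (I.nreq * I.n)) :=
          Nat.mul_le_mul (by omega) (by omega)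
        have e3 : I.nreq * (263 * (I.nreq * I.n)) = 263 * (I.nreq ^ 2 * I.n) := by ring
        have e4 : 1 ≤ I.nreq ^ 2 * I.n := Nat.mul_pos (pow_pos hq 2) hn
        omega
  · intro μ' t h1 ht
    refine ⟨h1.1, fun a b k i1 i2 i3 => h1.2 a b k i1 i2 i3 (by omega), ?_⟩
    simp only [List.length_nil]
    have e4 : 1 ≤ I.nreq ^ 2 * I.n := Nat.mul_pos (pow_pos hq 2) hn
    have e1 : I.nreq * (270 * (I.nreq ^ 2 * I.n) + 1) ≤ I.nreq * (271 * (I.nreq ^ 2 * I.n)) :=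
      Nat.mul_le_mul le_rfl (by omega)
    have e3 : I.nreq * (271 * (I.nreq ^ 2 * I.n)) = 271 * (I.nreq ^ 3 * I.n) := by ring
    have e5 : 1 ≤ I.nreq ^ 3 * I.n := Nat.mul_pos (pow_pos hq 3) hn
    omega

end DP

/-! ### Recovering the detours -/

theorem LTSP.recovered_range {I : LTSP} (ch : ℕ → ℕ → ℕ → ℕ) : ∀ N a b k c, b - a ≤ N →
    k + I.before (b + 1) ≤ I.n → (recovered I.mult ch a b k c).1 ≠ 0 →
    (recovered I.mult ch a b k c).2 + I.before (recovered I.mult ch a b k c).1 ≤ I.n := by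
  intro N
  induction N with
  | zero =>
    intro a b k c h _ h0
    rw [recovered_of_le _ ch (by omega)] at h0
    exact absurd rfl h0
  | succ N ih =>
    intro a b k c h hk h0
    by_cases hab : a < b
    swap
    · rw [recovered_of_le _ ch (by omega)] at h0
      exact absurd rfl h0
    by_cases hch : a < ch a b k ∧ ch a b k ≤ b
    · obtain ⟨h1, h2⟩ := hch
      rcases lt_trichotomy c (ch a b k) with h3 | h3 | h3
      · rw [recovered_left _ ch h1 h2 h3] at h0 ⊢
        exact ih a _ k c (by omega)
          ((Nat.add_le_add_left (I.before_mono (by omega)) k).trans hk) h0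
      · rw [h3, recovered_here _ ch h1 h2]
        exact hk
      · rw [recovered_right _ ch h1 h2 h3] at h0 ⊢
        exact ih _ b k c (by omega) hk h0
    · rw [recovered_skip _ ch hab hch] at h0 ⊢
      refine ih a (b - 1) _ c (by omega) ?_ h0
      have := I.before_succ b
      rw [Nat.sub_add_cancel (by omega)]
      omega

namespace DP

open Prog Mem LTSP

variable {I : LTSP}

/-- For each recorded start `a`, only the chain of cells with first coordinate `a` is followed.
Detours nested deeper are left until the outer loop arrives at the larger start that contains them,
so quadratic time suffices. -/
theorem spec_traceBack {μ : Mem ℝ} (hμ : Prepared I μ) (h9 : ∀ idx, μ.nat 9 idx = 0)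
    (hdone : ∀ a b k, a ≤ b → b < I.nreq → k + I.before (b + 1) ≤ I.n → CellDone I μ a b k) :
    Spec (traceBack : Prog ℕ ℝ) μ fun μ' t => SameExcept [9, 10, 11, 12] [] μ μ' ∧
      μ'.nat 9 [0] = I.nreq ∧ (∀ c, 0 < c → c < I.nreq → μ'.nat 9 [c] =
        (recovered I.mult (fun a b k => μ.nat 8 [a, b, k]) 0 (I.nreq - 1) 0 c).1) ∧
      t ≤ 200 * I.nreq ^ 2 := by
  have hq := I.nreq_pos
  set ch : ℕ → ℕ → ℕ → ℕ := fun a b k => μ.nat 8 [a, b, k] with hchdef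
  set full : ℕ → ℕ × ℕ := fun c =>
    if c = 0 then (I.nreq, 0) else recovered I.mult ch 0 (I.nreq - 1) 0 c with hfull
  have full_pos : ∀ c, 0 < c → full c = recovered I.mult ch 0 (I.nreq - 1) 0 c := fun c hc =>
    if_neg hc.ne'
  have hrange0 : 0 + I.before (I.nreq - 1 + 1) ≤ I.n := by
    rw [Nat.sub_add_cancel hq, I.before_nreq, Nat.zero_add]
  have full_spec : ∀ c < I.nreq, (full c).1 ≠ 0 → c < (full c).1 ∧ (full c).1 ≤ I.nreq ∧
      (full c).2 + I.before (full c).1 ≤ I.n ∧ ∀ c', c < c' → c' ≤ (full c).1 - 1 →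
        full c' = recovered I.mult ch c ((full c).1 - 1) (full c).2 c' := by
    intro c hc h0
    rcases Nat.eq_zero_or_pos c with rfl | hc0
    · refine ⟨hq, le_rfl, ?_, fun c' h1 _ => full_pos c' h1⟩
      simp [hfull, I.before_nreq]
    · rw [full_pos c hc0] at h0 ⊢
      obtain ⟨h1, h2, h3, h4⟩ := recovered_spec I.mult ch _ 0 _ 0 c le_rfl h0
      refine ⟨h2, by omega, recovered_range ch _ 0 _ 0 c le_rfl hrange0 h0, fun c' h5 h6 => ?_⟩
      rw [full_pos c' (by omega)]
      exact h4 c' h5 (by omega)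
  simp only [traceBack, spec_const, spec_loadN, spec_seq, spec_storeN]
  simp only [qA, endA, nskipA, curBA, curKA, choiceA, xA, hμ.q]
  -- Every entry is absent or correct, and every missing detour starts inside a recorded one that is
  -- still to be processed. At `a = nreq` no such detour remains, so nothing is missing.
  refine spec_loop (fun a μ' => SameExcept [9, 10, 11, 12] [] μ μ' ∧
    (∀ c < I.nreq, μ'.nat 9 [c] = 0 ∨ (μ'.nat 9 [c], μ'.nat 10 [c]) = full c) ∧
    ∀ c < I.nreq, μ'.nat 9 [c] = 0 → (full c).1 ≠ 0 →
      ∃ c', a ≤ c' ∧ c' < c ∧ μ'.nat 9 [c'] ≠ 0 ∧ c < μ'.nat 9 [c']) (60 + 40 * I.nreq) ?_ ?_ ?_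
  · refine ⟨((SameExcept.refl _ _ _).setNat (by simp) _ _).setNat (by simp) _ _, ?_, ?_⟩
    · intro c hc
      rcases Nat.eq_zero_or_pos c with rfl | hc0
      · right
        simp [hfull]
      · left
        simp [h9, hc0.ne']
    · intro c hc h0 _
      have hc0 : c ≠ 0 := by
        rintro rfl
        simp at h0
        omega
      refine ⟨0, le_rfl, by omega, ?_, ?_⟩
      · simpa using hq.ne'
      · simpa using hc
  · rintro a ha μ1 ⟨h1, h2, h3⟩
    simp only [spec_loadN, spec_ifLtN, spec_seq, spec_subN, spec_storeN, spec_halt]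
    refine ⟨fun hpos => ?_, fun h0 => ⟨⟨h1, h2, fun c hc i1 i2 => ?_⟩,
      by simp only [List.length_cons, List.length_nil]; omega⟩⟩
    swap
    · obtain ⟨c', j1, j2, j3, j4⟩ := h3 c hc i1 i2
      rcases (by omega : c' = a ∨ a + 1 ≤ c') with rfl | h'
      · omega
      · exact ⟨c', h', j2, j3, j4⟩
    have hfa : (μ1.nat 9 [a], μ1.nat 10 [a]) = full a := (h2 a ha).resolve_left (by omega)
    have hf1 : (full a).1 = μ1.nat 9 [a] := by rw [← hfa]
    have hf2 : (full a).2 = μ1.nat 10 [a] := by rw [← hfa]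
    obtain ⟨g1, g2, g3, g4⟩ := full_spec a ha (by omega)
    rw [hf1] at g1 g2 g3 g4
    rw [hf2] at g3 g4
    -- A missing detour starts in the part `(a, b]` still to be traced or inside a recorded detour
    -- with a start beyond `a`. Each active iteration lowers `b`, so `nreq` iterations bring it down
    -- to `a`.
    refine spec_loop (fun i μ' => SameExcept [9, 10, 11, 12] [] μ μ' ∧
      a ≤ μ'.nat 11 [] ∧ μ'.nat 11 [] < I.nreq ∧ (μ'.nat 11 [] ≤ a ∨ μ'.nat 11 [] + i < I.nreq) ∧
      μ'.nat 12 [] + I.before (μ'.nat 11 [] + 1) ≤ I.n ∧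
      (∀ c, a < c → c ≤ μ'.nat 11 [] →
        full c = recovered I.mult ch a (μ'.nat 11 []) (μ'.nat 12 []) c) ∧
      (∀ c < I.nreq, μ'.nat 9 [c] = 0 ∨ (μ'.nat 9 [c], μ'.nat 10 [c]) = full c) ∧
      ∀ c < I.nreq, μ'.nat 9 [c] = 0 → (full c).1 ≠ 0 → (a < c ∧ c ≤ μ'.nat 11 []) ∨
        ∃ c', a + 1 ≤ c' ∧ c' < c ∧ μ'.nat 9 [c'] ≠ 0 ∧ c < μ'.nat 9 [c']) 39 ?_ ?_ ?_
    · simp only [setNat_nat]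
      norm_num
      refine ⟨(h1.setNat (by simp) _ _).setNat (by simp) _ _, by omega, by omega, by omega, ?_,
        g4, h2, fun c hc i1 i2 => ?_⟩
      · rwa [Nat.sub_add_cancel (by omega)]
      · obtain ⟨c', j1, j2, j3, j4⟩ := h3 c hc i1 i2
        rcases (by omega : c' = a ∨ a < c') with rfl | h'
        · exact Or.inl ⟨j2, by omega⟩
        · exact Or.inr ⟨c', h', j2, j3, j4⟩
    · rintro i hi μ2 ⟨k1, k2, k3, k4, k5, k6, k7, k8⟩
      have hP : Prepared I μ2 := hμ.of_same k1 (by simp) (by simp)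
      have hc : ∀ idx, μ2.nat 8 idx = μ.nat 8 idx := k1.1 8 (by simp)
      have hx := hP.x _ k3
      simp only [spec_loadN, spec_ifLtN, spec_seq, spec_subN, spec_addN, spec_storeN, spec_halt, hc,
        hx]
      set b := μ2.nat 11 [] with hb
      set k := μ2.nat 12 [] with hk
      refine ⟨fun hab => ?_, fun hba => ⟨⟨k1, k2, k3, by omega, k5, k6, k7, k8⟩, by simp⟩⟩
      have hch := (hdone a b k k2 k3 k5).2 hab
      change (ch a b k = 0 ∧ _) ∨ (a < ch a b k ∧ ch a b k ≤ b ∧ _) at hch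
      have hbs := I.before_succ b
      obtain ⟨c₀, hc₀⟩ : ∃ c₀, ch a b k = c₀ := ⟨_, rfl⟩
      rw [show μ.nat 8 [a, b, k] = c₀ from hc₀]
      rw [hc₀] at hch
      refine ⟨fun hpos₀ => ?_, fun hpos₀ => ?_⟩
      · obtain ⟨m1, m2⟩ : a < c₀ ∧ c₀ ≤ b := by omega
        have hh : full c₀ = (b + 1, k) := by
          rw [k6 _ m1 m2, ← hc₀, recovered_here I.mult ch (by omega) (by omega)]
        refine ⟨⟨((k1.setNat (by simp) _ _).setNat (by simp) _ _).setNat (by simp) _ _, ?_⟩,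
          by simp⟩
        simp only [setNat_nat, List.cons.injEq]
        norm_num
        rw [← hk]
        refine ⟨by omega, by omega, by omega, ?_, fun c n1 n2 => ?_, fun c n1 => ?_,
          fun c n1 n2 n3 => ?_⟩
        · exact (Nat.add_le_add_left (I.before_mono (by omega)) k).trans k5
        · rw [k6 c n1 (by omega), recovered_left I.mult ch (by omega) (by omega) (by omega), hc₀]
        · by_cases hcc : c = c₀
          · right
            rw [if_pos hcc, if_pos hcc, hcc, hh]
          · rw [if_neg hcc, if_neg hcc]
            exact k7 c n1
        · by_cases hcc : c = c₀
          · rw [if_pos hcc] at n2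
            omega
          rw [if_neg hcc] at n2
          rcases k8 c n1 n2 n3 with ⟨n4, n5⟩ | ⟨c', n4, n5, n6, n7⟩
          · rcases (by omega : c < c₀ ∨ c₀ < c) with n6 | n6
            · exact Or.inl ⟨n4, by omega⟩
            · refine Or.inr ⟨c₀, m1, n6, ?_, ?_⟩
              · rw [if_pos rfl]
                omega
              · rw [if_pos rfl]
                omega
          · refine Or.inr ⟨c', n4, n5, ?_, ?_⟩
            · split_ifs
              · exact not_false
              · exact n6
            -- An entry already present at `c₀` is overwritten with the same end.
            · split_ifs with hcc'
              · have := (k7 c' (by omega)).resolve_left n6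
                rw [hcc', hh, Prod.mk.injEq] at this
                rw [hcc', this.1] at n7
                exact n7
              · exact n7
      · obtain rfl : c₀ = 0 := by omega
        have hr := recovered_skip I.mult ch (a := a) (b := b) (k := k) hab (by omega)
        refine ⟨⟨(k1.setNat (by simp) _ _).setNat (by simp) _ _, ?_⟩, by simp⟩
        simp only [setNat_nat]
        norm_num
        refine ⟨by omega, by omega, by omega, ?_, fun c n1 n2 => ?_, k7, fun c n1 n2 n3 => ?_⟩
        · rw [Nat.sub_add_cancel (by omega)]
          omega
        · rw [k6 c n1 (by omega), hr]
        · rcases k8 c n1 n2 n3 with ⟨n4, n5⟩ | n4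
          · refine Or.inl ⟨n4, ?_⟩
            rw [k6 c n4 n5, hr] at n3
            have := recovered_spec I.mult ch _ a (b - 1) (k + I.mult b) c le_rfl n3
            omega
          · exact Or.inr n4
    · rintro μ2 t ⟨k1, k2, k3, k4, k5, k6, k7, k8⟩ ht
      refine ⟨⟨k1, k7, fun c hc i1 i2 => ?_⟩, ?_⟩
      · rcases k8 c hc i1 i2 with h' | h'
        · omega
        · exact h'
      · simp only [List.length_cons, List.length_nil]
        omega
  · rintro μ1 t ⟨h1, h2, h3⟩ ht
    have hall : ∀ c < I.nreq, μ1.nat 9 [c] = (full c).1 := by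
      intro c hc
      rcases h2 c hc with h' | h'
      · by_contra hne
        obtain ⟨c', j1, j2, _⟩ := h3 c hc h' (by omega)
        omega
      · rw [← h']
    refine ⟨h1, ?_, fun c h0 hc => ?_, ?_⟩
    · rw [hall 0 hq]
      rfl
    · rw [hall c hc, full_pos c h0]
    · simp only [List.length_nil, List.length_cons]
      have e1 : I.nreq * (60 + 40 * I.nreq + 1) = 61 * I.nreq + 40 * I.nreq ^ 2 := by ring
      have e2 : I.nreq ≤ I.nreq ^ 2 := Nat.le_self_pow (by norm_num) _
      omega

end DP

/-! ### Writing the schedule and its cost -/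

namespace DP

open Prog Mem LTSP

variable {I : LTSP}

theorem spec_writeOutput {μ : Mem ℝ} (hμ : Prepared I μ) (h0 : μ.nat 9 [0] = I.nreq)
    (he : ∀ c < I.nreq, μ.nat 9 [c] = 0 ∨ c < μ.nat 9 [c] ∧ μ.nat 9 [c] ≤ I.nreq) :
    Spec (writeOutput : Prog ℕ ℝ) μ fun μ' t => SameExcept [13] [8, 9] μ μ' ∧
      I.Performs (fun c => μ.nat 9 [c]) 0 (μ'.nat 13 []) (fun k => μ'.val 8 [k]) ∧
      μ'.val 9 [] = μ.val 7 [0, I.nreq - 1, 0] + I.virtualLB ∧ t ≤ 200 * I.nreq := by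
  have hq := I.nreq_pos
  simp only [writeOutput, spec_const, spec_loadN, spec_loadV, spec_seq, spec_storeN, spec_storeV,
    spec_subN]
  simp only [qA, mA, UA, outA, movesA, endA, LA, RA, SA, tableA, costA, xA, hμ.q, hμ.m, hμ.penalty]
  -- Iteration `i` handles the start `nreq - 1 - i`, so the threshold of `Performs` descends from
  -- `nreq` to `0`.
  refine spec_loop (fun i μ' => SameExcept [13] [8] μ μ' ∧
    I.Performs (fun c => μ.nat 9 [c]) (I.nreq - i) (μ'.nat 13 []) (fun k => μ'.val 8 [k])) 50
    ⟨?_, ?_⟩ ?_ ?_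
  · exact ((SameExcept.refl _ _ _).setVal (by simp) _ _).setNat (by simp) _ _
  · simp only [setNat_nat, setNat_val, setVal_val]
    exact performs_zero (by simp)
  · rintro i hi μ' ⟨h1, h2⟩
    have hP : Prepared I μ' := hμ.of_same h1 (by simp) (by simp)
    have h9 : ∀ c, μ'.nat 9 [c] = μ.nat 9 [c] := fun c => h1.1 9 (by simp) _
    obtain ⟨a, ha⟩ : ∃ a, I.nreq - 1 - i = a := ⟨_, rfl⟩
    have haq : a < I.nreq := by omega
    rw [show I.nreq - i = a + 1 by omega] at h2
    rw [show I.nreq - (i + 1) = a by omega]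
    simp only [spec_loadN, spec_subN, spec_addN, spec_ifLtN, spec_seq, spec_storeN, spec_storeV,
      spec_loadV, spec_halt, ha, h9, hP.l a haq, setVal_val]
    refine ⟨fun hpos => ?_, fun hz => ⟨⟨h1, h2.of_no_detour h0 haq (by simpa using hz)⟩, by simp⟩⟩
    rcases he a haq with h' | ⟨h', h''⟩
    · omega
    have hr : μ'.val 6 [μ.nat 9 [a] - 1] = I.rpos (μ.nat 9 [a] - 1) := hP.r _ (by omega)
    refine ⟨⟨((h1.setVal (by simp) _ _).setVal (by simp) _ _).setNat (by simp) _ _, ?_⟩, by simp⟩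
    simp only [setNat_nat, setNat_val, setVal_val, List.cons.injEq]
    norm_num
    refine h2.detour (b := μ.nat 9 [a] - 1) h0 (by omega) (by omega) (by omega) ?_ ?_ ?_
    · intro k hk
      rw [if_neg (by omega), if_neg (by omega)]
    · rw [if_neg (by omega), if_pos rfl]
    · rw [if_pos rfl, hr]
  · rintro μ1 t ⟨h1, h2⟩ ht
    rw [Nat.sub_self] at h2
    refine spec_loop (fun i μ' => SameExcept [] [9] μ1 μ' ∧ μ'.val 9 [] =
      μ.val 7 [0, I.nreq - 1, 0] + ∑ j ∈ Finset.range i,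
        (I.mult j : ℝ) * (I.m - I.lpos j + I.s (I.file j) + I.U)) 50 ⟨?_, ?_⟩ ?_ ?_
    · exact (SameExcept.refl _ _ _).setVal (by simp) _ _
    · rw [setVal_val, if_pos ⟨rfl, rfl⟩, h1.2 7 (by simp)]
      simp
    · rintro i hi μ2 ⟨h3, h4⟩
      have hP : Prepared I μ2 := hμ.of_same (A := [13]) (B := [8, 9])
        ((h1.mono (by simp) (by simp)).trans (h3.mono (by simp) (by simp))) (by simp) (by simp)
      simp only [spec_loadN, spec_loadV, spec_cast, spec_subV, spec_addV, spec_mulV, spec_storeV,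
        hP.l i hi, hP.s i hi, hP.x i hi, h4]
      refine ⟨⟨h3.setVal (by simp) _ _, ?_⟩, by simp⟩
      rw [setVal_val, if_pos ⟨rfl, rfl⟩, Finset.sum_range_succ, add_assoc]
    · rintro μ2 t' ⟨h3, h4⟩ ht'
      refine ⟨(h1.mono (by simp) (by simp)).trans (h3.mono (by simp) (by simp)), ?_, ?_, ?_⟩
      · have e1 : (fun k => μ2.val 8 [k]) = fun k => μ1.val 8 [k] :=
          funext fun k => h3.2 8 (by simp) _
        rw [h3.1 13 (by simp), e1]
        exact h2
      · rw [h4, virtualLB_eq]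
      · simp only [List.length_nil, List.length_cons]
        omega

/-! ### Composition of the four phases -/

theorem spec_program (I : LTSP) : Spec (program ℕ ℝ) I.initMem fun μ t =>
    (∀ a b k, a ≤ b → b < I.nreq → k ≤ I.nright (I.file b) →
      μ.val tableA [a, b, k] = I.cell a b k) ∧
    μ.val costA [] = I.T I.first I.last 0 + I.virtualLB ∧
    (∃ e, 2 * I.halfDelay e 0 (I.nreq - 1) 0 = I.T I.first I.last 0 ∧
      I.Performs e 0 (μ.nat movesA []) fun k => μ.val outA [k]) ∧
    t ≤ 2000 * (I.nreq ^ 3 * I.n) := by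
  have hq := I.nreq_pos
  have hn := I.n_pos
  simp only [program, spec_seq, tableA, costA, movesA, outA]
  refine spec_prepare.mono fun μ1 t1 ⟨p1, z1, b1⟩ => ?_
  refine (spec_fillTable p1).mono fun μ2 t2 ⟨s2, d2, b2⟩ => ?_
  have p2 : Prepared I μ2 := p1.of_same s2 (by simp) (by simp)
  refine (spec_traceBack p2 (fun idx => (s2.1 9 (by simp) _).trans (z1 idx)) d2).mono
    fun μ3 t3 ⟨s3, e0, e3, b3⟩ => ?_
  have p3 : Prepared I μ3 := p2.of_same s3 (by simp) (by simp)
  have hlast : 0 + I.before (I.nreq - 1 + 1) ≤ I.n := by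
    rw [Nat.sub_add_cancel hq, I.before_nreq, Nat.zero_add]
  refine (spec_writeOutput p3 e0 fun c hc => ?_).mono fun μ4 t4 ⟨s4, f4, c4, b4⟩ => ?_
  · rcases Nat.eq_zero_or_pos c with rfl | h0
    · omega
    · rw [e3 c h0 hc]
      by_contra hne
      have := recovered_spec I.mult (fun a b k => μ2.nat 8 [a, b, k]) _ 0 (I.nreq - 1) 0 c le_rfl
        (by omega)
      omega
  · have h7 : ∀ idx, μ4.val 7 idx = μ2.val 7 idx := fun idx =>
      (s4.2 7 (by simp) _).trans (s3.2 7 (by simp) _)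
    have hT : I.T I.first I.last 0 = I.cell 0 (I.nreq - 1) 0 := by
      rw [first_eq, last_eq, cell]
    refine ⟨fun a b k hab hb hk => ?_, ?_, ⟨_, ?_, f4⟩, ?_⟩
    · rw [I.nright_file hb] at hk
      have := I.before_le_n (j := b + 1) hb
      rw [h7, (d2 a b k hab hb (by omega)).1]
    · rw [c4, s3.2 7 (by simp), (d2 0 (I.nreq - 1) 0 (Nat.zero_le _) (by omega) hlast).1, hT]
    · rw [hT]
      have hatt : I.Attains fun a b k => μ2.nat 8 [a, b, k] :=
        fun a b k hab hb hk => (d2 a b k hab.le hb hk).2 hab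
      exact hatt.halfDelay_eq _ 0 (I.nreq - 1) 0 le_rfl (Nat.zero_le _) (by omega) hlast
        fun c h1 h2 => e3 c h1 (by omega)
    · have n1 : I.nreq ^ 2 ≤ I.nreq ^ 3 * I.n :=
        (Nat.pow_le_pow_right hq (by norm_num)).trans (Nat.le_mul_of_pos_right _ hn)
      have n2 : I.nreq ≤ I.nreq ^ 2 := Nat.le_self_pow (by norm_num) _
      have n3 : I.nreq * I.n ≤ I.nreq ^ 3 * I.n :=
        Nat.mul_le_mul_right _ (Nat.le_self_pow (by norm_num) _)
      have n4 : I.n ≤ I.nreq * I.n := Nat.le_mul_of_pos_left _ hq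
      omega

theorem output_spec (I : LTSP) :
    (∀ a b k, a ≤ b → b < I.nreq → k ≤ I.nright (I.file b) →
      I.output.val tableA [a, b, k] = I.cell a b k) ∧
    I.output.val costA [] = I.T I.first I.last 0 + I.virtualLB ∧
    (∃ e, 2 * I.halfDelay e 0 (I.nreq - 1) 0 = I.T I.first I.last 0 ∧
      I.Performs e 0 (I.output.nat movesA []) fun k => I.output.val outA [k]) ∧
    I.runningTime ≤ 2000 * (I.nreq ^ 3 * I.n) := by
  have h := spec_program I
  unfold Spec at h
  unfold LTSP.output LTSP.runningTime
  exact h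

end DP

/-- The least cost of a feasible schedule is `T[first, last, 0] + VirtualLB`; the program `DP` computes
the table `T`, this cost and a schedule that attains it, in time `O(nreq ^ 3 * n)`. -/
theorem mainTheorem1 :
    (∀ I : LTSP,
      IsLeast {c : ℝ | ∃ τ : I.Trajectory, τ.Feasible ∧ τ.cost = c}
        (I.T I.first I.last 0 + I.virtualLB)) ∧
    (∀ I : LTSP,
      (∀ i j k : ℕ, i ≤ j → j < I.nreq →
        k ≤ I.nright (Nat.nth (fun f => f ∈ I.requested) j) →
        I.output.val DP.tableA [i, j, k] =
          I.T (Nat.nth (fun f => f ∈ I.requested) i) (Nat.nth (fun f => f ∈ I.requested) j) k) ∧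
      I.output.val DP.costA [] = I.T I.first I.last 0 + I.virtualLB ∧
      ∃ τ : I.Trajectory,
        τ.moves = I.output.nat DP.movesA [] ∧
        (∀ k ≤ τ.moves, τ.pos k = I.output.val DP.outA [k]) ∧
        τ.Feasible ∧ τ.cost = I.output.val DP.costA []) ∧
    (∃ C : ℕ, ∀ I : LTSP, I.runningTime ≤ C * (I.nreq ^ 3 * I.n)) := by
  have schedule : ∀ I : LTSP, ∃ τ : I.Trajectory, τ.moves = I.output.nat DP.movesA [] ∧
      (∀ k ≤ τ.moves, τ.pos k = I.output.val DP.outA [k]) ∧ τ.Feasible ∧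
      τ.cost = I.T I.first I.last 0 + I.virtualLB := by
    intro I
    obtain ⟨_, _, ⟨e, he, h⟩, _⟩ := DP.output_spec I
    obtain ⟨τ, h1, h2, h3, h4⟩ := h.exists_trajectory
    rw [he] at h4
    -- The constructed schedule costs at most the value of the program, and no feasible schedule
    -- costs less.
    exact ⟨τ, h1, h2, h3, le_antisymm h4 h3.le_cost⟩
  refine ⟨fun I => ⟨?_, ?_⟩, fun I => ?_, 2000, fun I => (DP.output_spec I).2.2.2⟩
  · obtain ⟨τ, _, _, h1, h2⟩ := schedule I
    exact ⟨τ, h1, h2⟩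
  · rintro _ ⟨τ, h, rfl⟩
    exact h.le_cost
  · obtain ⟨h1, h2, _⟩ := DP.output_spec I
    refine ⟨h1, h2, ?_⟩
    obtain ⟨τ, h3, h4, h5, h6⟩ := schedule I
    exact ⟨τ, h3, h4, h5, h6.trans h2.symm⟩
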